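/- Let $X$ be a complex Banach space with open unit ball $B_X$. Let $\mathrm{Lip}_0(B_X)$ be the space of Lipschitz functions $f:B_X\to\mathbb C$ with $f(0)=0$, normed by the Lipschitz constant $L(f)$; let $\mathcal H^\infty(B_X)$ be the space of bounded holomorphic functions $B_X\to\mathbb C$ with the supremum norm; and let $\mathcal HL_0(B_X)=\mathrm{Lip}_0(B_X)\cap\mathcal H^\infty(B_X)$ with the norm $L(\cdot)$. For $x\in B_X$ let $\delta(x)$ denote evaluation at $x$ (on whichever of these spaces), and for $x\in B_X$, $y\in X$ let $e_{x,y}(f)=df(x)(y)$ for $f\in\mathcal HL_0(B_X)$. Let $\mathcal F(B_X)$ be the Lipschitz-free space, i.e. the closed linear span of $\{\delta(x):x\in B_X\}$ in $\mathrm{Lip}_0(B_X)^*$; let $\mathcal G_0(B_X)\subset\mathcal HL_0(B_X)^*$ and $\mathcal G^\infty(B_X)\subset\mathcal H^\infty(B_X)^*$ be the subspaces of those functionals whose restriction to the closed unit ball of $\mathcal HL_0(B_X)$, respectively $\mathcal H^\infty(B_X)$, is continuous for the compact-open topology. All three carry the dual norms. A bounded operator $T:E\to F$ is a quotient operator if it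 is surjective and $\|v\|=\inf\{\|u\|:Tu=v\}$ for all $v\in F$. (a) There is a unique bounded operator $\pi:\mathcal F(B_X)\to\mathcal G_0(B_X)$ with $\pi(\delta(x))=\delta(x)$ for all $x\in B_X$. It is a quotient operator with kernel $\mathcal HL_0(B_X)_\perp=\{\mu\in\mathcal F(B_X):\langle f,\mu\rangle=0\ \ \forall f\in\mathcal HL_0(B_X)\}$, and it induces an isometric isomorphism $\mathcal F(B_X)/\mathcal HL_0(B_X)_\perp\cong\mathcal G_0(B_X)$. (b) There is a unique bounded operator $\Psi:\mathcal G^\infty(B_X)\hat\otimes_\pi X\to\mathcal G_0(B_X)$ on the completed projective tensor product with $\Psi(\delta(x)\otimes y)=e_{x,y}$ for all $x\in B_X$, $y\in X$ (in particular $e_{x,y}\in\mathcal G_0(B_X)$). It is a quotient operator. If $X\ne\{0\}$, then $\|\Psi\|=1$, and $\Psi$ is injective if and only if $X$ is isometrically isomorphic to $\mathbb C$. (c) In particular, for the unit disc $\mathbb D=B_{\mathbb C}$, there is an isometric isomorphism from $\mathcal G^\infty(\mathbb D)$ onto $\mathcal G_0(\mathbb D)$ which maps $\delta(x)$ to $e_{x,1}$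 for every $x\in\mathbb D$. -/

import Mathlib

open scoped TensorProduct

noncomputable section

namespace HolLip

/-! ### Functions on the open unit ball -/

/-- The open unit ball `B_X` of `X`, as a type. -/
abbrev UBall (X : Type*) [NormedAddCommGroup X] : Type _ := Metric.ball (0 : X) 1

/-- The centre of the ball, the base point. -/
def origin (X : Type*) [NormedAddCommGroup X] : UBall X := ⟨0, by simp⟩

open Classical in
/-- Extension by zero of a function on `B_X`; only its values on the open ball matter below. -/
def extend {X : Type*} [NormedAddCommGroup X] (f : UBall X → ℂ) (x : X) : ℂ :=
  if h : x ∈ Metric.ball (0 : X) 1 then f ⟨x, h⟩ else 0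

theorem extend_coe {X : Type*} [NormedAddCommGroup X] (f : UBall X → ℂ) (x : UBall X) :
    extend f (x : X) = f x := by
  have h : (x : X) ∈ Metric.ball (0 : X) 1 := x.2
  simp [extend]

theorem extend_add {X : Type*} [NormedAddCommGroup X] (f g : UBall X → ℂ) :
    extend (f + g) = extend f + extend g := by
  funext x; by_cases h : x ∈ Metric.ball (0 : X) 1 <;>
    simp only [extend, h, dite_true, dite_false, Pi.add_apply, add_zero]

theorem extend_smul {X : Type*} [NormedAddCommGroup X] (c : ℂ) (f : UBall X → ℂ) :
    extend (c • f) = c • extend f := by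
  funext x; by_cases h : x ∈ Metric.ball (0 : X) 1 <;>
    simp only [extend, h, dite_true, dite_false, Pi.smul_apply, smul_zero]

theorem extend_zero {X : Type*} [NormedAddCommGroup X] :
    extend (0 : UBall X → ℂ) = 0 := by
  funext x; by_cases h : x ∈ Metric.ball (0 : X) 1 <;>
    simp only [extend, h, dite_true, dite_false, Pi.zero_apply]

/-- `f : B_X → ℂ` is holomorphic: complex Fréchet differentiable at each point of `B_X`. -/
def Holo {X : Type*} [NormedAddCommGroup X] [NormedSpace ℂ X] (f : UBall X → ℂ) : Prop :=
  DifferentiableOn ℂ (extend f) (Metric.ball (0 : X) 1)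

/-- The differential `df(x) : X → ℂ` of `f : B_X → ℂ` at a point of the ball. -/
def differential {X : Type*} [NormedAddCommGroup X] [NormedSpace ℂ X] (f : UBall X → ℂ)
    (x : UBall X) : X →L[ℂ] ℂ :=
  fderiv ℂ (extend f) (x : X)

theorem Holo.differentiableAt {X : Type*} [NormedAddCommGroup X] [NormedSpace ℂ X]
    {f : UBall X → ℂ} (hf : Holo f) (x : UBall X) : DifferentiableAt ℂ (extend f) (x : X) :=
  DifferentiableOn.differentiableAt hf (Metric.isOpen_ball.mem_nhds x.2)

theorem Holo.add {X : Type*} [NormedAddCommGroup X] [NormedSpace ℂ X]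
    {f g : UBall X → ℂ} (hf : Holo f) (hg : Holo g) : Holo (f + g) := by
  unfold Holo at *; rw [extend_add]; exact DifferentiableOn.add hf hg

theorem Holo.smul {X : Type*} [NormedAddCommGroup X] [NormedSpace ℂ X]
    {f : UBall X → ℂ} (c : ℂ) (hf : Holo f) : Holo (c • f) := by
  unfold Holo at *; rw [extend_smul]; exact DifferentiableOn.const_smul hf c

theorem Holo.zero {X : Type*} [NormedAddCommGroup X] [NormedSpace ℂ X] :
    Holo (0 : UBall X → ℂ) := by
  unfold Holo; rw [extend_zero]; exact differentiableOn_const 0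

/-! ### The space `Lip₀(B_X)` -/

/-- The vector space of Lipschitz functions `f : B_X → ℂ` with `f 0 = 0`. -/
def lip0Submodule (X : Type*) [NormedAddCommGroup X] : Submodule ℂ (UBall X → ℂ) where
  carrier := {f | (∃ C : ℝ, ∀ x y, ‖f x - f y‖ ≤ C * ‖(x : X) - y‖) ∧ f (origin X) = 0}
  add_mem' := by
    rintro f g ⟨⟨C, hC⟩, hf⟩ ⟨⟨D, hD⟩, hg⟩
    refine ⟨⟨C + D, fun x y => ?_⟩, by simp [hf, hg]⟩
    have h : (f + g) x - (f + g) y = (f x - f y) + (g x - g y) := by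
      simp only [Pi.add_apply]; ring
    rw [h, add_mul]
    exact (norm_add_le _ _).trans (add_le_add (hC x y) (hD x y))
  zero_mem' := ⟨⟨0, by simp⟩, rfl⟩
  smul_mem' := by
    rintro c f ⟨⟨C, hC⟩, hf⟩
    refine ⟨⟨‖c‖ * C, fun x y => ?_⟩, by simp [hf]⟩
    have h : (c • f) x - (c • f) y = c * (f x - f y) := by
      simp only [Pi.smul_apply, smul_eq_mul]; ring
    rw [h, norm_mul, mul_assoc]
    exact mul_le_mul_of_nonneg_left (hC x y) (norm_nonneg _)

/-- The space `Lip₀(B_X)`, a type of its own so that its only topology is the norm topology. -/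
def Lip0 (X : Type*) [NormedAddCommGroup X] : Type _ := lip0Submodule X

namespace Lip0

variable {X : Type*} [NormedAddCommGroup X]

instance : AddCommGroup (Lip0 X) := inferInstanceAs (AddCommGroup (lip0Submodule X))
instance : Module ℂ (Lip0 X) := inferInstanceAs (Module ℂ (lip0Submodule X))

/-- The underlying function on the ball. -/
def toFun (f : Lip0 X) : UBall X → ℂ := Subtype.val f

@[simp] theorem toFun_add (f g : Lip0 X) : (f + g).toFun = f.toFun + g.toFun := rfl
@[simp] theorem toFun_smul (c : ℂ) (f : Lip0 X) : (c • f).toFun = c • f.toFun := rfl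
@[simp] theorem toFun_zero : (0 : Lip0 X).toFun = 0 := rfl

/-- The Lipschitz constant `L(f) = sup ‖f x - f y‖ / ‖x - y‖` (the terms with `x = y` are `0`). -/
instance : Norm (Lip0 X) :=
  ⟨fun f => ⨆ p : UBall X × UBall X, ‖f.toFun p.1 - f.toFun p.2‖ / ‖(p.1 : X) - p.2‖⟩

theorem norm_def (f : Lip0 X) :
    ‖f‖ = ⨆ p : UBall X × UBall X, ‖f.toFun p.1 - f.toFun p.2‖ / ‖(p.1 : X) - p.2‖ := rfl

theorem bddAbove (f : Lip0 X) : BddAbove (Set.range fun p : UBall X × UBall X =>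
    ‖f.toFun p.1 - f.toFun p.2‖ / ‖(p.1 : X) - p.2‖) := by
  obtain ⟨⟨C, hC⟩, -⟩ := f.2
  refine ⟨|C|, ?_⟩
  rintro _ ⟨p, rfl⟩
  refine div_le_of_le_mul₀ (norm_nonneg _) (abs_nonneg _) ?_
  exact (hC p.1 p.2).trans (mul_le_mul_of_nonneg_right (le_abs_self C) (norm_nonneg _))

theorem norm_nonneg' (f : Lip0 X) : 0 ≤ ‖f‖ :=
  Real.iSup_nonneg fun _ => div_nonneg (norm_nonneg _) (norm_nonneg _)

theorem norm_sub_le (f : Lip0 X) (x y : UBall X) :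
    ‖f.toFun x - f.toFun y‖ ≤ ‖f‖ * ‖(x : X) - y‖ := by
  rcases eq_or_ne x y with rfl | h
  · simp
  · have hpos : 0 < ‖(x : X) - y‖ := norm_pos_iff.2 (sub_ne_zero.2 fun e => h (Subtype.ext e))
    rw [← div_le_iff₀ hpos]
    exact le_ciSup f.bddAbove (x, y)

theorem norm_le_of (f : Lip0 X) {C : ℝ} (hC : 0 ≤ C)
    (h : ∀ x y, ‖f.toFun x - f.toFun y‖ ≤ C * ‖(x : X) - y‖) : ‖f‖ ≤ C := by
  have : Nonempty (UBall X) := ⟨origin X⟩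
  exact ciSup_le fun p => div_le_of_le_mul₀ (norm_nonneg _) hC (h p.1 p.2)

theorem map_origin (f : Lip0 X) : f.toFun (origin X) = 0 := f.2.2

theorem norm_apply_le (f : Lip0 X) (x : UBall X) : ‖f.toFun x‖ ≤ ‖f‖ * ‖(x : X)‖ := by
  have h := f.norm_sub_le x (origin X)
  rw [map_origin, sub_zero] at h
  simpa only [origin, sub_zero] using h

theorem norm_smul_le' (c : ℂ) (f : Lip0 X) : ‖c • f‖ ≤ ‖c‖ * ‖f‖ := by
  refine norm_le_of _ (mul_nonneg (norm_nonneg _) f.norm_nonneg') fun x y => ?_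
  have h : (c • f).toFun x - (c • f).toFun y = c * (f.toFun x - f.toFun y) := by
    simp only [toFun_smul, Pi.smul_apply, smul_eq_mul]; ring
  rw [h, norm_mul, mul_assoc]
  exact mul_le_mul_of_nonneg_left (f.norm_sub_le x y) (norm_nonneg _)

theorem core : NormedSpace.Core ℂ (Lip0 X) where
  norm_nonneg := norm_nonneg'
  norm_smul c f := by
    refine le_antisymm (norm_smul_le' c f) ?_
    rcases eq_or_ne c 0 with rfl | hc
    · simpa using norm_nonneg' _
    · have h := norm_smul_le' c⁻¹ (c • f)
      rw [inv_smul_smul₀ hc, norm_inv] at h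
      rwa [← le_inv_mul_iff₀ (norm_pos_iff.2 hc)]
  norm_triangle f g := by
    refine norm_le_of _ (add_nonneg f.norm_nonneg' g.norm_nonneg') fun x y => ?_
    have h : (f + g).toFun x - (f + g).toFun y
        = (f.toFun x - f.toFun y) + (g.toFun x - g.toFun y) := by
      simp only [toFun_add, Pi.add_apply]; ring
    rw [h, add_mul]
    exact (norm_add_le _ _).trans (add_le_add (f.norm_sub_le x y) (g.norm_sub_le x y))
  norm_eq_zero_iff f := by
    constructor
    · intro h
      refine Subtype.ext (funext fun x => ?_)
      have := f.norm_apply_le x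
      rw [h, zero_mul] at this
      exact norm_le_zero_iff.1 this
    · rintro rfl
      refine le_antisymm (norm_le_of _ le_rfl fun x y => ?_) (norm_nonneg' _)
      simp

instance : NormedAddCommGroup (Lip0 X) := NormedAddCommGroup.ofCore core
instance : NormedSpace ℂ (Lip0 X) := NormedSpace.ofCore core

theorem continuous_toFun (f : Lip0 X) : Continuous f.toFun := by
  have h : LipschitzWith ⟨‖f‖, f.norm_nonneg'⟩ f.toFun := by
    refine LipschitzWith.of_dist_le_mul fun x y => ?_
    rw [dist_eq_norm, Subtype.dist_eq, dist_eq_norm]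
    exact f.norm_sub_le x y
  exact h.continuous

end Lip0

/-! ### The spaces `H^∞(B_X)` and `HL₀(B_X)` -/

/-- The vector space of bounded holomorphic functions on `B_X`. -/
def hInfSubmodule (X : Type*) [NormedAddCommGroup X] [NormedSpace ℂ X] :
    Submodule ℂ (BoundedContinuousFunction (UBall X) ℂ) where
  carrier := {f | Holo (f : UBall X → ℂ)}
  add_mem' := fun hf hg => Holo.add hf hg
  zero_mem' := Holo.zero
  smul_mem' := fun c _ hf => Holo.smul c hf

/-- The space `H^∞(B_X)` of bounded holomorphic functions on `B_X`, with the supremum norm. -/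
def HInf (X : Type*) [NormedAddCommGroup X] [NormedSpace ℂ X] : Type _ := hInfSubmodule X

namespace HInf

variable {X : Type*} [NormedAddCommGroup X] [NormedSpace ℂ X]

instance : NormedAddCommGroup (HInf X) := inferInstanceAs (NormedAddCommGroup (hInfSubmodule X))
instance : NormedSpace ℂ (HInf X) := inferInstanceAs (NormedSpace ℂ (hInfSubmodule X))

/-- The underlying bounded continuous function on the ball. -/
def toBCF (f : HInf X) : BoundedContinuousFunction (UBall X) ℂ := Subtype.val f

end HInf

/-- The intersection `Lip₀(B_X) ∩ H^∞(B_X)`, as a subspace of `Lip₀(B_X)`. -/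
def hl0Submodule (X : Type*) [NormedAddCommGroup X] [NormedSpace ℂ X] :
    Submodule ℂ (Lip0 X) where
  carrier := {f | ∃ g ∈ hInfSubmodule X, (g : UBall X → ℂ) = f.toFun}
  add_mem' := by
    rintro f f' ⟨g, hg, h⟩ ⟨g', hg', h'⟩
    exact ⟨g + g', (hInfSubmodule X).add_mem hg hg', by rw [Lip0.toFun_add, ← h, ← h']; rfl⟩
  zero_mem' := ⟨0, (hInfSubmodule X).zero_mem, rfl⟩
  smul_mem' := by
    rintro c f ⟨g, hg, h⟩
    exact ⟨c • g, (hInfSubmodule X).smul_mem c hg, by rw [Lip0.toFun_smul, ← h]; rfl⟩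

/-- The space `HL₀(B_X) = Lip₀(B_X) ∩ H^∞(B_X)`, with the norm `L(·)` of `Lip₀(B_X)`. -/
def HL0 (X : Type*) [NormedAddCommGroup X] [NormedSpace ℂ X] : Type _ := hl0Submodule X

namespace HL0

variable {X : Type*} [NormedAddCommGroup X] [NormedSpace ℂ X]

instance : NormedAddCommGroup (HL0 X) := inferInstanceAs (NormedAddCommGroup (hl0Submodule X))
instance : NormedSpace ℂ (HL0 X) := inferInstanceAs (NormedSpace ℂ (hl0Submodule X))

/-- The inclusion of `HL₀(B_X)` into `Lip₀(B_X)`. -/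
def toLip (f : HL0 X) : Lip0 X := Subtype.val f

theorem holo (f : HL0 X) : Holo f.toLip.toFun := by
  obtain ⟨g, hg, h⟩ := f.2
  exact h ▸ hg

theorem norm_toLip (f : HL0 X) : ‖f.toLip‖ = ‖f‖ := rfl

end HL0

/-! ### Preduals -/

/-- For a normed space `E` with a map `ev` into `C(B, ℂ)`, the functionals `φ ∈ E*` whose
restriction to the closed unit ball of `E` is continuous for the compact-open topology
(the topology induced by `ev` from the compact-open topology of `C(B, ℂ)`). -/
def ballContinuousDual {B E : Type*} [TopologicalSpace B] [NormedAddCommGroup E]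
    [NormedSpace ℂ E] (ev : E → C(B, ℂ)) : Submodule ℂ (StrongDual ℂ E) where
  carrier := {φ | @ContinuousOn E ℂ (TopologicalSpace.induced ev inferInstance) _ φ
    (Metric.closedBall (0 : E) 1)}
  add_mem' := by
    intro φ ψ hφ hψ
    exact @ContinuousOn.add ℂ _ _ _ E (TopologicalSpace.induced ev inferInstance) _ _ _ hφ hψ
  zero_mem' :=
    @continuousOn_const E ℂ (TopologicalSpace.induced ev inferInstance) _ _ _
  smul_mem' := by
    intro c φ hφ
    exact @ContinuousOn.const_smul ℂ ℂ E _ _ _ (TopologicalSpace.induced ev inferInstance)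
      _ _ hφ c

theorem mem_ballContinuousDual_of_eval {B E : Type*} [TopologicalSpace B]
    [NormedAddCommGroup E] [NormedSpace ℂ E] (ev : E → C(B, ℂ)) (φ : StrongDual ℂ E) (x : B)
    (h : ∀ f, φ f = ev f x) : φ ∈ ballContinuousDual ev := by
  have h' : (φ : E → ℂ) = (fun g : C(B, ℂ) => g x) ∘ ev := funext h
  show @ContinuousOn E ℂ (TopologicalSpace.induced ev inferInstance) _ φ _
  rw [h']
  exact @Continuous.continuousOn E ℂ (TopologicalSpace.induced ev inferInstance) _ _ _
    (@Continuous.comp E _ ℂ (TopologicalSpace.induced ev inferInstance) _ _ _ _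
      (ContinuousEvalConst.continuous_eval_const x) continuous_induced_dom)

section Preduals

variable (X : Type*) [NormedAddCommGroup X] [NormedSpace ℂ X]

/-- An element of `HL₀(B_X)` as a continuous function. -/
def HL0.toContinuousMap (f : HL0 X) : C(UBall X, ℂ) :=
  ⟨f.toLip.toFun, f.toLip.continuous_toFun⟩

/-- An element of `H^∞(B_X)` as a continuous function. -/
def HInf.toContinuousMap (f : HInf X) : C(UBall X, ℂ) :=
  f.toBCF.toContinuousMap

/-- `G₀(B_X)`, the canonical predual of `HL₀(B_X)`, with the norm of `HL₀(B_X)*`. -/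
def G0 : Type _ := ballContinuousDual (HL0.toContinuousMap X)

instance : NormedAddCommGroup (G0 X) :=
  inferInstanceAs (NormedAddCommGroup (ballContinuousDual (HL0.toContinuousMap X)))
instance : NormedSpace ℂ (G0 X) :=
  inferInstanceAs (NormedSpace ℂ (ballContinuousDual (HL0.toContinuousMap X)))

/-- `G^∞(B_X)`, Mujica's canonical predual of `H^∞(B_X)`, with the norm of `H^∞(B_X)*`. -/
def GInf : Type _ := ballContinuousDual (HInf.toContinuousMap X)

instance : NormedAddCommGroup (GInf X) :=
  inferInstanceAs (NormedAddCommGroup (ballContinuousDual (HInf.toContinuousMap X)))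
instance : NormedSpace ℂ (GInf X) :=
  inferInstanceAs (NormedSpace ℂ (ballContinuousDual (HInf.toContinuousMap X)))

variable {X}

/-- The evaluation functional `f ↦ f x` on `Lip₀(B_X)`. -/
def evalLip (x : UBall X) : StrongDual ℂ (Lip0 X) :=
  LinearMap.mkContinuous
    { toFun := fun f => f.toFun x
      map_add' := fun _ _ => rfl
      map_smul' := fun _ _ => rfl } ‖(x : X)‖
    (fun f => (f.norm_apply_le x).trans_eq (mul_comm _ _))

/-- The evaluation functional `f ↦ f x` on `H^∞(B_X)`. -/
def evalInf (x : UBall X) : StrongDual ℂ (HInf X) :=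
  LinearMap.mkContinuous
    { toFun := fun f => f.toBCF x
      map_add' := fun _ _ => rfl
      map_smul' := fun _ _ => rfl } 1
    (fun f => (f.toBCF.norm_coe_le_norm x).trans_eq (one_mul _).symm)

variable (X) in
/-- The Lipschitz-free space `F(B_X)`: the closed linear span of the evaluations in `Lip₀(B_X)*`. -/
def lipFreeSubmodule : Submodule ℂ (StrongDual ℂ (Lip0 X)) :=
  (Submodule.span ℂ (Set.range (evalLip (X := X)))).topologicalClosure

variable (X) in
/-- The Lipschitz-free space `F(B_X)` with the norm of `Lip₀(B_X)*`. -/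
def LipFree : Type _ := lipFreeSubmodule X

instance : NormedAddCommGroup (LipFree X) :=
  inferInstanceAs (NormedAddCommGroup (lipFreeSubmodule X))
instance : NormedSpace ℂ (LipFree X) := inferInstanceAs (NormedSpace ℂ (lipFreeSubmodule X))

/-- An element of `F(B_X)` as a functional on `Lip₀(B_X)`. -/
def LipFree.toDual (μ : LipFree X) : StrongDual ℂ (Lip0 X) := Subtype.val μ

/-- An element of `G₀(B_X)` as a functional on `HL₀(B_X)`. -/
def G0.toDual (φ : G0 X) : StrongDual ℂ (HL0 X) := Subtype.val φ

/-- An element of `G^∞(B_X)` as a functional on `H^∞(B_X)`. -/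
def GInf.toDual (φ : GInf X) : StrongDual ℂ (HInf X) := Subtype.val φ

/-- The point evaluation `δ(x) ∈ F(B_X)`. -/
def deltaF (x : UBall X) : LipFree X :=
  ⟨evalLip x, Submodule.le_topologicalClosure _ (Submodule.subset_span ⟨x, rfl⟩)⟩

/-- The evaluation functional `f ↦ f x` on `HL₀(B_X)`. -/
def evalHL (x : UBall X) : StrongDual ℂ (HL0 X) :=
  LinearMap.mkContinuous
    { toFun := fun f => f.toLip.toFun x
      map_add' := fun _ _ => rfl
      map_smul' := fun _ _ => rfl } ‖(x : X)‖
    (fun f => (f.toLip.norm_apply_le x).trans_eq (mul_comm _ _))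

/-- The point evaluation `δ(x) ∈ G₀(B_X)`. -/
def delta0 (x : UBall X) : G0 X :=
  ⟨evalHL x, mem_ballContinuousDual_of_eval _ _ x fun _ => rfl⟩

/-- The point evaluation `δ(x) ∈ G^∞(B_X)`. -/
def deltaInf (x : UBall X) : GInf X :=
  ⟨evalInf x, mem_ballContinuousDual_of_eval _ _ x fun _ => rfl⟩

theorem norm_differential_le (f : Lip0 X) (x : UBall X) :
    ‖differential f.toFun x‖ ≤ ‖f‖ := by
  refine norm_fderiv_le_of_lip' ℂ f.norm_nonneg' ?_
  filter_upwards [Metric.isOpen_ball.mem_nhds x.2] with z hz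
  have h := f.norm_sub_le ⟨z, hz⟩ x
  rwa [← extend_coe f.toFun ⟨z, hz⟩, ← extend_coe f.toFun x] at h

/-- The functional `e_{x,y} : f ↦ df(x)(y)` on `HL₀(B_X)`. -/
def evalDeriv (x : UBall X) (y : X) : StrongDual ℂ (HL0 X) :=
  LinearMap.mkContinuous
    { toFun := fun f => differential f.toLip.toFun x y
      map_add' := fun f g => by
        have h : (f + g).toLip.toFun = f.toLip.toFun + g.toLip.toFun := rfl
        simp only [differential, h, extend_add]
        rw [fderiv_add (f.holo.differentiableAt x) (g.holo.differentiableAt x)]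
        rfl
      map_smul' := fun c f => by
        have h : (c • f).toLip.toFun = c • f.toLip.toFun := rfl
        simp only [differential, h, extend_smul]
        rw [fderiv_const_smul (f.holo.differentiableAt x)]
        rfl } ‖y‖
    (fun f => by
      refine ((differential f.toLip.toFun x).le_opNorm y).trans ?_
      rw [mul_comm]
      exact mul_le_mul_of_nonneg_left (norm_differential_le f.toLip x) (norm_nonneg _))

variable (X) in
/-- The pre-annihilator `HL₀(B_X)_⊥ = {μ ∈ F(B_X) : ⟨f, μ⟩ = 0 for all f ∈ HL₀(B_X)}`. -/
def HL0perp : Submodule ℂ (LipFree X) where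
  carrier := {μ | ∀ f : HL0 X, μ.toDual f.toLip = 0}
  add_mem' := fun {μ ν} hμ hν f => by
    show μ.toDual f.toLip + ν.toDual f.toLip = 0
    rw [hμ f, hν f, add_zero]
  zero_mem' := fun _ => rfl
  smul_mem' := fun c μ hμ f => by
    show c • μ.toDual f.toLip = 0
    rw [hμ f, smul_zero]

end Preduals

/-! ### The completed projective tensor product -/

/-- The algebraic tensor product `E ⊗ F`, a type of its own that carries the projective norm. -/
def PreProj (E F : Type*) [NormedAddCommGroup E] [NormedSpace ℂ E] [NormedAddCommGroup F]
    [NormedSpace ℂ F] : Type _ := E ⊗[ℂ] F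

namespace PreProj

variable {E F : Type*} [NormedAddCommGroup E] [NormedSpace ℂ E] [NormedAddCommGroup F]
  [NormedSpace ℂ F]

instance : AddCommGroup (PreProj E F) := inferInstanceAs (AddCommGroup (E ⊗[ℂ] F))
instance : Module ℂ (PreProj E F) := inferInstanceAs (Module ℂ (E ⊗[ℂ] F))

variable (E F) in
/-- The universal bilinear map `(x, y) ↦ x ⊗ y`. -/
def mk : E →ₗ[ℂ] F →ₗ[ℂ] PreProj E F := TensorProduct.mk ℂ E F

/-- The numbers `∑ ‖xᵢ‖ ‖yᵢ‖` over all finite representations `u = ∑ xᵢ ⊗ yᵢ`. -/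
def costs (u : PreProj E F) : Set ℝ :=
  {r | ∃ l : List (E × F), u = (l.map fun p => mk E F p.1 p.2).sum ∧
    r = (l.map fun p => ‖p.1‖ * ‖p.2‖).sum}

/-- The projective norm: the infimum of `∑ ‖xᵢ‖ ‖yᵢ‖` over the representations `u = ∑ xᵢ ⊗ yᵢ`. -/
instance : Norm (PreProj E F) := ⟨fun u => sInf (costs u)⟩

theorem norm_def (u : PreProj E F) : ‖u‖ = sInf (costs u) := rfl

theorem costs_nonneg {u : PreProj E F} {r : ℝ} (h : r ∈ costs u) : 0 ≤ r := by
  obtain ⟨l, -, rfl⟩ := h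
  refine List.sum_nonneg fun a ha => ?_
  obtain ⟨p, -, rfl⟩ := List.mem_map.1 ha
  positivity

theorem costs_bddBelow (u : PreProj E F) : BddBelow (costs u) := ⟨0, fun _ => costs_nonneg⟩

theorem costs_add {u v : PreProj E F} {r s : ℝ} (hr : r ∈ costs u) (hs : s ∈ costs v) :
    r + s ∈ costs (u + v) := by
  obtain ⟨l, rfl, rfl⟩ := hr
  obtain ⟨m, rfl, rfl⟩ := hs
  exact ⟨l ++ m, by simp, by simp⟩

theorem costs_smul (c : ℂ) {u : PreProj E F} {r : ℝ} (hr : r ∈ costs u) :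
    ‖c‖ * r ∈ costs (c • u) := by
  obtain ⟨l, rfl, rfl⟩ := hr
  refine ⟨l.map fun p => (c • p.1, p.2), ?_, ?_⟩
  · simp [List.smul_sum, Function.comp_def]
  · simp [Function.comp_def, norm_smul, mul_assoc, List.sum_map_mul_left]

theorem costs_nonempty (u : PreProj E F) : (costs u).Nonempty := by
  refine TensorProduct.induction_on (motive := fun u : E ⊗[ℂ] F =>
    (costs (show PreProj E F from u)).Nonempty) u ⟨0, [], rfl, rfl⟩ ?_ ?_
  · exact fun x y => ⟨‖x‖ * ‖y‖, [(x, y)], by simp [mk]; rfl, by simp⟩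
  · rintro u v ⟨r, hr⟩ ⟨s, hs⟩
    exact ⟨r + s, costs_add hr hs⟩

theorem norm_nonneg' (u : PreProj E F) : 0 ≤ ‖u‖ := Real.sInf_nonneg fun _ => costs_nonneg

theorem norm_smul_le' (c : ℂ) (u : PreProj E F) : ‖c • u‖ ≤ ‖c‖ * ‖u‖ := by
  refine le_of_forall_pos_le_add fun ε hε => ?_
  obtain ⟨r, hr, hlt⟩ := exists_lt_of_csInf_lt (costs_nonempty u)
    (show sInf (costs u) < ‖u‖ + ε / (‖c‖ + 1) from lt_add_of_pos_right _ (by positivity))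
  have h1 : ‖c • u‖ ≤ ‖c‖ * r := csInf_le (costs_bddBelow _) (costs_smul c hr)
  have h2 : ‖c‖ * r ≤ ‖c‖ * (‖u‖ + ε / (‖c‖ + 1)) :=
    mul_le_mul_of_nonneg_left hlt.le (norm_nonneg _)
  have h3 : ‖c‖ * (ε / (‖c‖ + 1)) ≤ ε := by
    rw [← mul_div_assoc, div_le_iff₀ (by positivity)]
    nlinarith [norm_nonneg c]
  linarith

theorem core : SeminormedSpace.Core ℂ (PreProj E F) where
  norm_nonneg := norm_nonneg'
  norm_smul c u := by
    refine le_antisymm (norm_smul_le' c u) ?_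
    rcases eq_or_ne c 0 with rfl | hc
    · simpa using norm_nonneg' _
    · have h := norm_smul_le' c⁻¹ (c • u)
      rw [inv_smul_smul₀ hc, norm_inv] at h
      rwa [← le_inv_mul_iff₀ (norm_pos_iff.2 hc)]
  norm_triangle u v := by
    refine le_of_forall_pos_le_add fun ε hε => ?_
    obtain ⟨r, hr, hlt⟩ := exists_lt_of_csInf_lt (costs_nonempty u)
      (show sInf (costs u) < ‖u‖ + ε / 2 from lt_add_of_pos_right _ (by positivity))
    obtain ⟨s, hs, hlt'⟩ := exists_lt_of_csInf_lt (costs_nonempty v)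
      (show sInf (costs v) < ‖v‖ + ε / 2 from lt_add_of_pos_right _ (by positivity))
    have h : ‖u + v‖ ≤ r + s := csInf_le (costs_bddBelow _) (costs_add hr hs)
    linarith

instance : SeminormedAddCommGroup (PreProj E F) := SeminormedAddCommGroup.ofCore core
instance : NormedSpace ℂ (PreProj E F) where
  norm_smul_le := norm_smul_le'

end PreProj

/-- The completed projective tensor product of `E` and `F`. -/
def ProjTensor (E F : Type*) [NormedAddCommGroup E] [NormedSpace ℂ E] [NormedAddCommGroup F]
    [NormedSpace ℂ F] : Type _ := UniformSpace.Completion (PreProj E F)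

section ProjTensor

variable {E F : Type*} [NormedAddCommGroup E] [NormedSpace ℂ E] [NormedAddCommGroup F]
  [NormedSpace ℂ F]

instance : NormedAddCommGroup (ProjTensor E F) :=
  inferInstanceAs (NormedAddCommGroup (UniformSpace.Completion (PreProj E F)))
instance : NormedSpace ℂ (ProjTensor E F) :=
  inferInstanceAs (NormedSpace ℂ (UniformSpace.Completion (PreProj E F)))

/-- The elementary tensor `x ⊗ y` in the completed projective tensor product. -/
def ptmul (x : E) (y : F) : ProjTensor E F :=
  ((PreProj.mk E F x y : PreProj E F) : UniformSpace.Completion (PreProj E F))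

end ProjTensor

/-! ### Quotient operators -/

/-- `T` is a quotient operator: it is surjective and `‖v‖ = inf {‖u‖ : T u = v}` for all `v`. -/
def IsQuotientOperator {E F : Type*} [NormedAddCommGroup E] [NormedSpace ℂ E]
    [NormedAddCommGroup F] [NormedSpace ℂ F] (T : E →L[ℂ] F) : Prop :=
  Function.Surjective T ∧ ∀ v : F, IsGLB {r : ℝ | ∃ u : E, T u = v ∧ r = ‖u‖} ‖v‖

end HolLip

end

open scoped TensorProduct

noncomputable section

namespace HolLip

open Filter Topology

/-! ### Quotient operators and duality -/

/-! The space `G0 X` is a predual of `HL0 X`: a functional `φ` on `G0 X` is evaluation at the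
function `x ↦ φ (δ x)`, constructed in `HL0.ofDual`. Two facts give this. The evaluations span a
dense subspace of `G0 X`, because the unit ball of `HL0 X` is equicontinuous
(`mem_closure_span_of_equicontinuous`). The map `x ↦ δ x` is differentiable in norm, with derivative
`y ↦ e_{x,y}`, because the second order Cauchy estimate is uniform over that ball; hence `e_{x,y}`
lies in `G0 X` and the representing function is holomorphic.

The operator `π` restricts functionals from `Lip0 X` to `HL0 X`, and `Ψ` sends `φ ⊗ y` to `f ↦ φ
(df(·)(y))`. Under the duality their transposes are the inclusion of `HL0 X` in `Lip0 X` and the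
differential `f ↦ df`. Both preserve norms, the second by the mean value inequality on the convex
ball. A short operator on a Banach space whose transpose does not decrease norms is a quotient
operator, by Hahn–Banach separation and a geometric series (`isQuotientOperator_of_dual`).

If `Ψ` is injective, it is an isomorphism, so every `a ⊗ b` with `a`, `b` in the dual of `X` comes
from some `f` with `df(x)(y) = a(x) b(y)`. Symmetry of the second derivative gives `a(y) b(z) = a(z)
b(y)`, which forces dimension one. Conversely, on a disc every bounded holomorphic `g` has a
primitive with Lipschitz constant at most `‖g‖`; so `φ ↦ Ψ (φ ⊗ y)` is isometric for a unit vector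
`y`, and every tensor has the form `φ ⊗ y`. The same map is the isometry of part (c). -/

/-- If `T` is short and its transpose does not decrease norms, every vector of `F` is approximated
by images of vectors of at most the same norm. -/
theorem exists_approx_preimage {E F : Type*} [NormedAddCommGroup E] [NormedSpace ℂ E]
    [NormedAddCommGroup F] [NormedSpace ℂ F] (T : E →L[ℂ] F)
    (hdual : ∀ φ : StrongDual ℂ F, ‖φ‖ ≤ ‖φ.comp T‖) (v : F) {ε : ℝ} (hε : 0 < ε) :
    ∃ u : E, ‖u‖ ≤ ‖v‖ ∧ ‖v - T u‖ < ε := by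
  by_contra! hcon
  let _ : NormedSpace ℝ E := NormedSpace.restrictScalars ℝ ℂ E
  let _ : NormedSpace ℝ F := NormedSpace.restrictScalars ℝ ℂ F
  set s : Set F := closure (T '' Metric.closedBall 0 ‖v‖) with hs
  have hconv : Convex ℝ s := by
    refine Convex.closure ?_
    have := (convex_closedBall (0 : E) ‖v‖).linear_image ((T : E →ₗ[ℂ] F).restrictScalars ℝ)
    simpa using this
  have hv : v ∉ s := by
    intro hmem
    obtain ⟨_, ⟨u, hu, rfl⟩, hd⟩ := Metric.mem_closure_iff.1 hmem ε hε
    have := hcon u (by simpa using hu)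
    rw [dist_eq_norm] at hd
    linarith
  obtain ⟨φ, c, hlt, hc⟩ := RCLike.geometric_hahn_banach_closed_point (𝕜 := ℂ) hconv
    isClosed_closure hv
  -- Separation controls only the real part of `φ (T u)`; multiplying `u` by a unimodular scalar
  -- turns this into a bound on the modulus.
  have hre : ∀ u : E, ‖u‖ ≤ ‖v‖ → ‖φ (T u)‖ ≤ c := by
    intro u hu
    rcases eq_or_ne (φ (T u)) 0 with h0 | h0
    · have := hlt (T 0) (subset_closure ⟨0, by simp, rfl⟩)
      simp only [map_zero] at this
      rw [h0, norm_zero]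
      exact this.le
    · have hn : (‖φ (T u)‖ : ℂ) ≠ 0 := by simpa using h0
      have hmem : T ((starRingEnd ℂ (φ (T u)) / ‖φ (T u)‖) • u) ∈ s := by
        refine subset_closure ⟨_, ?_, rfl⟩
        rw [mem_closedBall_zero_iff, norm_smul, norm_div, RCLike.norm_conj, Complex.norm_real,
          norm_norm, div_self (norm_ne_zero_iff.2 h0), one_mul]
        exact hu
      have h1 := hlt _ hmem
      rw [map_smul, map_smul, smul_eq_mul, div_mul_eq_mul_div, mul_comm (starRingEnd ℂ _),
        Complex.mul_conj, Complex.normSq_eq_norm_sq] at h1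
      have h2 : (((‖φ (T u)‖ ^ 2 : ℝ) : ℂ) / ‖φ (T u)‖) = ((‖φ (T u)‖ : ℝ) : ℂ) := by
        push_cast
        field_simp
      rw [h2] at h1
      simpa using h1.le
  have hv0 : 0 < ‖v‖ := by
    rw [norm_pos_iff]
    rintro rfl
    exact hv (subset_closure ⟨0, by simp, by simp⟩)
  have hc0 : 0 ≤ c := (norm_nonneg _).trans (hre 0 (by simp))
  -- By `hdual` this bound passes to `φ`, so `‖φ v‖ ≤ c`, against the strict separation `c < re (φ
  -- v)`.
  have hbound : ‖φ.comp T‖ ≤ c / ‖v‖ := by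
    refine ContinuousLinearMap.opNorm_le_of_unit_norm (by positivity) fun u hu => ?_
    have h := hre ((‖v‖ : ℂ) • u) (by simp [norm_smul, hu])
    rw [map_smul, map_smul, norm_smul, Complex.norm_real, norm_norm] at h
    rw [le_div_iff₀ hv0, mul_comm]
    exact h
  have h3 : ‖φ v‖ ≤ c := by
    calc ‖φ v‖ ≤ ‖φ‖ * ‖v‖ := φ.le_opNorm v
      _ ≤ c / ‖v‖ * ‖v‖ := by gcongr; exact (hdual φ).trans hbound
      _ = c := by field_simp
  have h4 := Complex.re_le_norm (φ v)
  simp only [RCLike.re_to_complex] at hc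
  linarith

/-- Approximate preimages of norm at most `‖v‖` yield exact preimages of norm at most
`(1 - ε)⁻¹ * ‖v‖`. -/
theorem exists_preimage_norm_le {E F : Type*} [NormedAddCommGroup E] [NormedSpace ℂ E]
    [CompleteSpace E] [NormedAddCommGroup F] [NormedSpace ℂ F] (T : E →L[ℂ] F)
    (happ : ∀ (v : F) (ε : ℝ), 0 < ε → ∃ u : E, ‖u‖ ≤ ‖v‖ ∧ ‖v - T u‖ < ε) (v : F) {ε : ℝ}
    (hε : 0 < ε) (hε1 : ε < 1) : ∃ u : E, T u = v ∧ ‖u‖ ≤ (1 - ε)⁻¹ * ‖v‖ := by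
  have happ' : ∀ v : F, ∃ u : E, ‖u‖ ≤ ‖v‖ ∧ ‖v - T u‖ ≤ ε * ‖v‖ := by
    intro v
    rcases eq_or_ne v 0 with rfl | hv
    · exact ⟨0, by simp, by simp⟩
    · obtain ⟨u, hu, h⟩ := happ v (ε * ‖v‖) (mul_pos hε (norm_pos_iff.2 hv))
      exact ⟨u, hu, h.le⟩
  choose g hg hgT using happ'
  -- `h` returns the error left by an approximate preimage. It shrinks norms by the factor `ε`, so
  -- the successive corrections form a convergent series whose images telescope to `v`.
  set h : F → F := fun w => w - T (g w) with hh
  have hiter : ∀ n, ‖h^[n] v‖ ≤ ‖v‖ * ε ^ n := by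
    intro n
    induction n with
    | zero => simp
    | succ n ih =>
      rw [Function.iterate_succ_apply']
      calc ‖h (h^[n] v)‖ ≤ ε * ‖h^[n] v‖ := hgT _
        _ ≤ ε * (‖v‖ * ε ^ n) := by gcongr
        _ = ‖v‖ * ε ^ (n + 1) := by ring
  have hbd : ∀ n, ‖g (h^[n] v)‖ ≤ ‖v‖ * ε ^ n := fun n => (hg _).trans (hiter n)
  have hgeo : HasSum (fun n => ‖v‖ * ε ^ n) (‖v‖ * (1 - ε)⁻¹) :=
    (hasSum_geometric_of_lt_one hε.le hε1).mul_left _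
  have hsum : Summable fun n => g (h^[n] v) := Summable.of_norm_bounded hgeo.summable hbd
  refine ⟨∑' n, g (h^[n] v), ?_, ?_⟩
  · have h1 := (T.hasSum hsum.hasSum).tendsto_sum_nat
    have h2 : ∀ n, ∑ i ∈ Finset.range n, T (g (h^[i] v)) = v - h^[n] v := by
      intro n
      induction n with
      | zero => simp
      | succ n ih =>
        rw [Finset.sum_range_succ, ih, Function.iterate_succ_apply']
        exact sub_add _ _ _
    simp only [h2] at h1
    have h3 : Tendsto (fun n => h^[n] v) atTop (𝓝 0) :=
      squeeze_zero_norm hiter hgeo.summable.tendsto_atTop_zero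
    have h4 := (tendsto_const_nhds (x := v)).sub h3
    rw [sub_zero] at h4
    exact tendsto_nhds_unique h1 h4
  · rw [mul_comm]
    exact tsum_of_norm_bounded hgeo hbd

/-- A short operator on a Banach space whose transpose does not decrease norms is a quotient
operator. -/
theorem isQuotientOperator_of_dual {E F : Type*} [NormedAddCommGroup E] [NormedSpace ℂ E]
    [CompleteSpace E] [NormedAddCommGroup F] [NormedSpace ℂ F] (T : E →L[ℂ] F)
    (hT : ∀ u, ‖T u‖ ≤ ‖u‖) (hdual : ∀ φ : StrongDual ℂ F, ‖φ‖ ≤ ‖φ.comp T‖) :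
    IsQuotientOperator T := by
  have key := exists_preimage_norm_le T fun v ε hε => exists_approx_preimage T hdual v hε
  refine ⟨fun v => ?_, fun v => ⟨?_, fun b hb => ?_⟩⟩
  · obtain ⟨u, hu, -⟩ := key v (ε := 1 / 2) (by norm_num) (by norm_num)
    exact ⟨u, hu⟩
  · rintro _ ⟨u, rfl, rfl⟩
    exact hT u
  · have hlim : Tendsto (fun ε : ℝ => (1 - ε)⁻¹ * ‖v‖) (𝓝[>] 0) (𝓝 ‖v‖) := by
      have : ContinuousAt (fun ε : ℝ => (1 - ε)⁻¹ * ‖v‖) 0 := by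
        have h0 : (1 : ℝ) - 0 ≠ 0 := by norm_num
        fun_prop (disch := assumption)
      simpa using this.tendsto.mono_left nhdsWithin_le_nhds
    refine ge_of_tendsto hlim ?_
    filter_upwards [Ioo_mem_nhdsGT (show (0 : ℝ) < 1 by norm_num)] with ε hε
    obtain ⟨u, hu, hn⟩ := key v hε.1 hε.2
    exact (hb ⟨u, hu, rfl⟩).trans hn

/-! ### The functionals that are continuous on the unit ball -/

theorem continuousOn_of_uniform_approx {α : Type*} [TopologicalSpace α] {s : Set α} {φ : α → ℂ}
    (h : ∀ ε > 0, ∃ ψ : α → ℂ, ContinuousOn ψ s ∧ ∀ x ∈ s, ‖φ x - ψ x‖ < ε) :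
    ContinuousOn φ s := by
  refine continuousOn_of_uniform_approx_of_continuousOn fun u hu => ?_
  obtain ⟨ε, hε, hu⟩ := Metric.mem_uniformity_dist.1 hu
  obtain ⟨ψ, hψ, hd⟩ := h ε hε
  exact ⟨ψ, hψ, fun x hx => hu (by rw [dist_eq_norm]; exact hd x hx)⟩

/-- Norm convergence of functionals is uniform convergence on the unit ball, which preserves
continuity there for any topology. -/
theorem isClosed_ballContinuousDual {B E : Type*} [TopologicalSpace B] [NormedAddCommGroup E]
    [NormedSpace ℂ E] (ev : E → C(B, ℂ)) :
    IsClosed (ballContinuousDual ev : Set (StrongDual ℂ E)) := by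
  refine isClosed_of_closure_subset fun φ hφ => ?_
  refine @continuousOn_of_uniform_approx E (TopologicalSpace.induced ev inferInstance) _ _
    fun ε hε => ?_
  obtain ⟨ψ, hψ, hd⟩ := Metric.mem_closure_iff.1 hφ ε hε
  refine ⟨ψ, hψ, fun f hf => ?_⟩
  rw [dist_eq_norm] at hd
  calc ‖φ f - ψ f‖ = ‖(φ - ψ) f‖ := rfl
    _ ≤ ‖φ - ψ‖ * ‖f‖ := (φ - ψ).le_opNorm f
    _ ≤ ‖φ - ψ‖ * 1 := by gcongr; simpa using hf
    _ < ε := by simpa using hd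

/-- A functional that is small on the part of the unit ball where finitely many functionals are
small is close to a linear combination of these. -/
theorem exists_mem_span_norm_sub_le {ι E : Type*} [NormedAddCommGroup E]
    [NormedSpace ℂ E] (δ : ι → StrongDual ℂ E) (t : Finset ι) {η ε : ℝ} (hη : 0 < η)
    (hε : 0 ≤ ε) (φ : StrongDual ℂ E)
    (h : ∀ f, ‖f‖ ≤ 1 → (∀ i ∈ t, ‖δ i f‖ ≤ η) → ‖φ f‖ ≤ ε) :
    ∃ ψ ∈ Submodule.span ℂ (Set.range δ), ‖φ - ψ‖ ≤ ε := by
  classical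
  -- The factor `η⁻¹` makes the unit ball of the graph of `ev`, in the max norm, the set on which
  -- `h` applies. So `φ`, read on the graph, has norm at most `ε`. A Hahn–Banach extension `g` to
  -- the product splits `φ` into the part of `g` on the second factor, a combination of the `δ i`,
  -- and the part on the first, the error.
  let ev : E →L[ℂ] (t → ℂ) := ContinuousLinearMap.pi fun i => ((η⁻¹ : ℝ) : ℂ) • δ i
  have hev : ∀ f i, ev f i = ((η⁻¹ : ℝ) : ℂ) * δ i f := fun _ _ => rfl
  let p : Submodule ℂ (E × (t → ℂ)) :=
    LinearMap.range ((ContinuousLinearMap.id ℂ E).prod ev : E →ₗ[ℂ] E × (t → ℂ))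
  let φp : StrongDual ℂ p := (φ.comp (ContinuousLinearMap.fst ℂ E (t → ℂ))).comp p.subtypeL
  have hφp : ‖φp‖ ≤ ε := by
    refine ContinuousLinearMap.opNorm_le_of_unit_norm hε ?_
    rintro ⟨_, f, rfl⟩ hw
    change ‖(f, ev f)‖ = 1 at hw
    change ‖φ f‖ ≤ ε
    rw [Prod.norm_def] at hw
    refine h f (hw ▸ le_max_left _ _) fun i hi => ?_
    have h1 : ‖ev f ⟨i, hi⟩‖ ≤ 1 := (norm_le_pi_norm _ _).trans (hw ▸ le_max_right _ _)
    rw [hev, norm_mul, Complex.norm_real, Real.norm_of_nonneg (by positivity),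
      inv_mul_le_iff₀ hη, mul_one] at h1
    exact h1
  obtain ⟨g, hg, hgn⟩ := exists_extension_norm_eq p φp
  refine ⟨(g.comp (ContinuousLinearMap.inr ℂ E (t → ℂ))).comp ev, ?_, ?_⟩
  · have : (g.comp (ContinuousLinearMap.inr ℂ E (t → ℂ))).comp ev =
        ∑ i : t, (g (0, Pi.single i 1) * ((η⁻¹ : ℝ) : ℂ)) • δ i := by
      ext f
      have hsum : ((0 : E), ev f) = ∑ i : t, ev f i • ((0 : E), Pi.single i (1 : ℂ)) := by
        refine Prod.ext (by simp [Prod.fst_sum]) ?_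
        rw [Prod.snd_sum]
        conv_lhs => rw [pi_eq_sum_univ' (ev f)]
        simp only [Prod.smul_snd]
      change g (0, ev f) = _
      rw [hsum, map_sum, sum_apply]
      refine Finset.sum_congr rfl fun i _ => ?_
      rw [map_smul, hev, smul_apply, smul_eq_mul, smul_eq_mul]
      ring
    rw [this]
    exact Submodule.sum_mem _ fun i _ =>
      Submodule.smul_mem _ _ (Submodule.subset_span ⟨i, rfl⟩)
  · refine ContinuousLinearMap.opNorm_le_bound _ hε fun f => ?_
    have h1 : φ f = g (f, ev f) := (hg ⟨(f, ev f), f, rfl⟩).symm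
    have h2 : (φ - (g.comp (ContinuousLinearMap.inr ℂ E (t → ℂ))).comp ev) f = g (f, 0) := by
      change φ f - g (0, ev f) = _
      rw [h1, ← map_sub]
      simp
    rw [h2]
    refine (g.le_opNorm _).trans ?_
    rw [hgn]
    have h3 : ‖((f, 0) : E × (t → ℂ))‖ = ‖f‖ := by simp [Prod.norm_def]
    rw [h3]
    gcongr

/-- If the functions in the unit ball are equicontinuous, the evaluations span a dense subspace of
the space of functionals that are continuous on the unit ball. -/
theorem mem_closure_span_of_equicontinuous {B E : Type*} [TopologicalSpace B]
    [NormedAddCommGroup E] [NormedSpace ℂ E] (ev : E → C(B, ℂ)) (δ : B → StrongDual ℂ E)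
    (hδ : ∀ x f, δ x f = ev f x)
    (hequi : ∀ x, ∀ ε > 0, ∃ U ∈ 𝓝 x, ∀ y ∈ U, ∀ f : E, ‖f‖ ≤ 1 → ‖δ y f - δ x f‖ < ε)
    {φ : StrongDual ℂ E} (hφ : φ ∈ ballContinuousDual ev) :
    φ ∈ (Submodule.span ℂ (Set.range δ)).topologicalClosure := by
  rw [← SetLike.mem_coe, Submodule.topologicalClosure_coe, Metric.mem_closure_iff]
  intro ε hε
  -- Only continuity at `0` is needed: it yields a compact `K` and `η > 0` such that `φ` is small on
  -- those elements of the unit ball that are smaller than `η` on `K`.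
  have hc : Tendsto φ (comap ev (𝓝 (ev 0)) ⊓ 𝓟 (Metric.closedBall (0 : E) 1)) (𝓝 (φ 0)) := by
    rw [← nhds_induced]
    exact hφ 0 (by simp)
  have hmem := hc (Metric.ball_mem_nhds (φ 0) (half_pos hε))
  rw [mem_map, mem_inf_principal, mem_comap] at hmem
  obtain ⟨S, hS, hSsub⟩ := hmem
  obtain ⟨⟨K, η⟩, ⟨hK, hη⟩, hKsub⟩ := (nhds_basis_uniformity'
    Metric.uniformity_basis_dist.compactConvergenceUniformity).mem_iff.1 hS
  simp only at hK hη
  -- Equicontinuity replaces `K` by finitely many points: `η / 2` for the variation on each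
  -- neighbourhood plus `η / 4` at its centre stays below `η`.
  choose U hU hUδ using fun x => hequi x (η / 2) (half_pos hη)
  obtain ⟨t, -, hcover⟩ := hK.elim_nhds_subcover U fun x _ => hU x
  have hsub : ∀ f : E, ‖f‖ ≤ 1 → (∀ i ∈ t, ‖δ i f‖ ≤ η / 4) → ‖φ f‖ ≤ ε / 2 := by
    intro f hf hsmall
    have hfS : ev f ∈ S := by
      refine hKsub fun x hx => ?_
      obtain ⟨i, hi, hxi⟩ := Set.mem_iUnion₂.1 (hcover hx)
      have h1 := hUδ i x hxi f hf
      have h2 := hsmall i hi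
      have h3 : ev 0 x = 0 := by rw [← hδ, map_zero]
      change dist (ev 0 x) (ev f x) < η
      rw [h3, ← hδ, dist_zero_left]
      have h4 := norm_add_le (δ x f - δ i f) (δ i f)
      rw [sub_add_cancel] at h4
      linarith
    have := hSsub hfS (by simpa using hf)
    rw [Set.mem_preimage, mem_ball_iff_norm, map_zero, sub_zero] at this
    exact this.le
  obtain ⟨ψ, hψ, hle⟩ := exists_mem_span_norm_sub_le δ t (by positivity) (by positivity) φ hsub
  exact ⟨ψ, hψ, by rw [dist_eq_norm]; linarith⟩

/-! ### The universal property of the projective tensor product -/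

section lift

variable {E F G : Type*} [NormedAddCommGroup E] [NormedSpace ℂ E] [NormedAddCommGroup F]
  [NormedSpace ℂ F] [NormedAddCommGroup G] [NormedSpace ℂ G]

theorem PreProj.norm_mk_le (x : E) (y : F) : ‖PreProj.mk E F x y‖ ≤ ‖x‖ * ‖y‖ :=
  csInf_le (PreProj.costs_bddBelow _) ⟨[(x, y)], by simp, by simp⟩

theorem norm_ptmul_le (x : E) (y : F) : ‖ptmul x y‖ ≤ ‖x‖ * ‖y‖ :=
  (UniformSpace.Completion.norm_coe (PreProj.mk E F x y)).trans_le (PreProj.norm_mk_le x y)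

/-- The linear map on the algebraic tensor product defined by a bounded bilinear map. -/
def PreProj.liftₗ (b : E →L[ℂ] F →L[ℂ] G) : PreProj E F →ₗ[ℂ] G :=
  TensorProduct.lift ((ContinuousLinearMap.coeLM ℂ).comp (b : E →ₗ[ℂ] F →L[ℂ] G))

theorem PreProj.liftₗ_mk (b : E →L[ℂ] F →L[ℂ] G) (x : E) (y : F) :
    PreProj.liftₗ b (PreProj.mk E F x y) = b x y :=
  TensorProduct.lift.tmul _ _

/-- Each representation of `u` bounds the image by `‖b‖` times its cost; the infimum over all
representations gives the projective norm. -/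
theorem PreProj.norm_liftₗ_le (b : E →L[ℂ] F →L[ℂ] G) (u : PreProj E F) :
    ‖PreProj.liftₗ b u‖ ≤ ‖b‖ * ‖u‖ := by
  have key : ∀ r ∈ PreProj.costs u, ‖PreProj.liftₗ b u‖ ≤ ‖b‖ * r := by
    rintro _ ⟨l, rfl, rfl⟩
    induction l with
    | nil => simp
    | cons p l ih =>
      simp only [List.map_cons, List.sum_cons, map_add, PreProj.liftₗ_mk, mul_add]
      refine (norm_add_le _ _).trans (add_le_add ?_ ih)
      rw [← mul_assoc]
      exact b.le_opNorm₂ _ _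
  rcases (norm_nonneg b).eq_or_lt with h0 | h0
  · obtain ⟨r, hr⟩ := PreProj.costs_nonempty u
    have := key r hr
    rwa [← h0, zero_mul] at this ⊢
  · rw [← div_le_iff₀' h0]
    exact le_csInf (PreProj.costs_nonempty u) fun r hr => (div_le_iff₀' h0).2 (key r hr)

/-- The bounded operator on the algebraic tensor product defined by a bounded bilinear map. -/
def PreProj.liftL (b : E →L[ℂ] F →L[ℂ] G) : PreProj E F →L[ℂ] G :=
  (PreProj.liftₗ b).mkContinuous ‖b‖ (PreProj.norm_liftₗ_le b)

variable (E F) in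
/-- The embedding of the algebraic tensor product into its completion. -/
def PreProj.toProj : PreProj E F →L[ℂ] ProjTensor E F :=
  (UniformSpace.Completion.toComplL : PreProj E F →L[ℂ] UniformSpace.Completion (PreProj E F))

theorem PreProj.denseRange_toProj : DenseRange (PreProj.toProj E F) :=
  UniformSpace.Completion.denseRange_coe

theorem PreProj.norm_toProj (u : PreProj E F) : ‖PreProj.toProj E F u‖ = ‖u‖ :=
  UniformSpace.Completion.norm_coe u

instance : CompleteSpace (ProjTensor E F) :=
  inferInstanceAs (CompleteSpace (UniformSpace.Completion (PreProj E F)))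

/-- The bounded operator on the completed projective tensor product defined by a bounded bilinear
map. -/
def ProjTensor.lift [CompleteSpace G] (b : E →L[ℂ] F →L[ℂ] G) : ProjTensor E F →L[ℂ] G :=
  (PreProj.liftL b).extend (PreProj.toProj E F)

theorem ProjTensor.lift_toProj [CompleteSpace G] (b : E →L[ℂ] F →L[ℂ] G) (u : PreProj E F) :
    ProjTensor.lift b (PreProj.toProj E F u) = PreProj.liftₗ b u :=
  ContinuousLinearMap.extend_eq _ PreProj.denseRange_toProj
    (UniformSpace.Completion.isUniformInducing_coe _) u

theorem ProjTensor.lift_ptmul [CompleteSpace G] (b : E →L[ℂ] F →L[ℂ] G) (x : E) (y : F) :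
    ProjTensor.lift b (ptmul x y) = b x y :=
  (ProjTensor.lift_toProj b _).trans (PreProj.liftₗ_mk b x y)

theorem ProjTensor.norm_lift_apply_le [CompleteSpace G] (b : E →L[ℂ] F →L[ℂ] G)
    (u : ProjTensor E F) : ‖ProjTensor.lift b u‖ ≤ ‖b‖ * ‖u‖ := by
  refine PreProj.denseRange_toProj.induction_on u
    (isClosed_le (by fun_prop) (by fun_prop)) fun w => ?_
  rw [ProjTensor.lift_toProj, PreProj.norm_toProj]
  exact PreProj.norm_liftₗ_le b w

variable (E F) in
/-- The bounded bilinear map `(x, y) ↦ x ⊗ y`. -/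
def ptmulL : E →L[ℂ] F →L[ℂ] ProjTensor E F :=
  LinearMap.mkContinuous₂ ((PreProj.mk E F).compr₂ (PreProj.toProj E F : PreProj E F →ₗ[ℂ] _)) 1
    fun x y => by rw [one_mul]; exact norm_ptmul_le x y

theorem PreProj.induction {p : PreProj E F → Prop} (u : PreProj E F) (hz : p 0)
    (hmk : ∀ x y, p (PreProj.mk E F x y)) (hadd : ∀ u v, p u → p v → p (u + v)) : p u :=
  TensorProduct.induction_on (motive := fun u : E ⊗[ℂ] F => p (show PreProj E F from u)) u
    hz hmk hadd

theorem ProjTensor.ext {S T : ProjTensor E F →L[ℂ] G}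
    (h : ∀ x y, S (ptmul x y) = T (ptmul x y)) : S = T := by
  have h1 : ∀ u, S (PreProj.toProj E F u) = T (PreProj.toProj E F u) := fun u =>
    PreProj.induction (p := fun u => S (PreProj.toProj E F u) = T (PreProj.toProj E F u)) u
      (by rw [map_zero, map_zero, map_zero]) h fun u v hu hv => by
      rw [map_add, map_add, map_add, hu, hv]
  exact DFunLike.coe_injective
    (PreProj.denseRange_toProj.equalizer S.continuous T.continuous (funext h1))

end lift

/-! ### Cauchy estimates in Banach spaces -/

/-- Schwarz-type estimates need a target ball centred at `f a`; recentring is the source of the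
factor 2 in the later constants. -/
theorem mapsTo_closedBall_of_bounded {E : Type*} [NormedAddCommGroup E] {f : E → ℂ} {a : E} {r M : ℝ}
    (hr : 0 < r) (hM : ∀ x ∈ Metric.ball a r, ‖f x‖ ≤ M) :
    Set.MapsTo f (Metric.ball a r) (Metric.closedBall (f a) (2 * M)) := by
  intro x hx
  rw [mem_closedBall_iff_norm]
  have h1 := norm_sub_le (f x) (f a)
  have h2 := hM x hx
  have h3 := hM a (Metric.mem_ball_self hr)
  linarith

section Cauchy

variable {E : Type*} [NormedAddCommGroup E] [NormedSpace ℂ E]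

theorem hasFDerivAt_of_quadratic {f : E → ℂ} {A : E →L[ℂ] ℂ} {a : E} {C : ℝ}
    (h : ∀ᶠ x in 𝓝 a, ‖f x - f a - A (x - a)‖ ≤ C * ‖x - a‖ ^ 2) : HasFDerivAt f A a := by
  refine HasFDerivAt.of_isLittleO ?_
  have h1 : (fun x => f x - f a - A (x - a)) =O[𝓝 a] fun x => ‖x - a‖ ^ 2 := by
    refine Asymptotics.IsBigO.of_bound C ?_
    filter_upwards [h] with x hx
    simpa using hx
  refine h1.trans_isLittleO ?_
  exact Asymptotics.isLittleO_pow_sub_sub a one_lt_two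

theorem norm_sub_le_of_bounded {f : E → ℂ} {a : E} {r M : ℝ} (hr : 0 < r)
    (hd : DifferentiableOn ℂ f (Metric.ball a r)) (hM : ∀ x ∈ Metric.ball a r, ‖f x‖ ≤ M) {x : E}
    (hx : x ∈ Metric.ball a r) : ‖f x - f a‖ ≤ 2 * M / r * ‖x - a‖ := by
  simpa only [dist_eq_norm] using
    Complex.dist_le_div_mul_dist_of_mapsTo_ball hd (mapsTo_closedBall_of_bounded hr hM) hx

theorem norm_fderiv_le_of_bounded {f : E → ℂ} {a : E} {r M : ℝ} (hr : 0 < r)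
    (hd : DifferentiableOn ℂ f (Metric.ball a r)) (hM : ∀ x ∈ Metric.ball a r, ‖f x‖ ≤ M) :
    ‖fderiv ℂ f a‖ ≤ 2 * M / r :=
  Complex.norm_fderiv_le_div_of_mapsTo_ball hd (mapsTo_closedBall_of_bounded hr hM) hr

/-- The second order Cauchy estimate. -/
theorem norm_sub_sub_fderiv_le {f : E → ℂ} {a : E} {r M : ℝ} (hr : 0 < r)
    (hd : DifferentiableOn ℂ f (Metric.ball a r)) (hM : ∀ x ∈ Metric.ball a r, ‖f x‖ ≤ M) {x : E}
    (hx : x ∈ Metric.ball a r) :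
    ‖f x - f a - fderiv ℂ f a (x - a)‖ ≤ 4 * M * (‖x - a‖ / r) ^ 2 := by
  have hfa : HasFDerivAt f (fderiv ℂ f a) a :=
    (hd.differentiableAt (Metric.ball_mem_nhds a hr)).hasFDerivAt
  -- The first order Taylor remainder is `o(‖z - a‖)` and bounded by `4 * M`, namely `2 * M` for the
  -- increment and `2 * M` for the linear term. The Schwarz lemma for zeros of higher order then
  -- gives quadratic decay.
  set g : E → ℂ := fun z => f z - f a - fderiv ℂ f a (z - a) with hg
  have hga : g a = 0 := by simp [hg]
  have hgd : DifferentiableOn ℂ g (Metric.ball a r) :=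
    (hd.sub_const _).sub (Differentiable.differentiableOn (by fun_prop))
  have hgm : Set.MapsTo g (Metric.ball a r) (Metric.closedBall (g a) (4 * M)) := by
    intro z hz
    rw [hga, mem_closedBall_zero_iff]
    have h1 := mapsTo_closedBall_of_bounded hr hM hz
    rw [mem_closedBall_iff_norm] at h1
    have h2 : ‖fderiv ℂ f a (z - a)‖ ≤ 2 * M := by
      have hM0 : 0 ≤ M := (norm_nonneg _).trans (hM a (Metric.mem_ball_self hr))
      calc ‖fderiv ℂ f a (z - a)‖ ≤ ‖fderiv ℂ f a‖ * ‖z - a‖ := (fderiv ℂ f a).le_opNorm _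
        _ ≤ 2 * M / r * r := by
          gcongr
          · exact norm_fderiv_le_of_bounded hr hd hM
          · exact (mem_ball_iff_norm.1 hz).le
        _ = 2 * M := by field_simp
    have h3 := norm_sub_le (f z - f a) (fderiv ℂ f a (z - a))
    linarith
  have hgo : (g · - g a) =o[𝓝 a] fun w => ‖w - a‖ ^ 1 := by
    simp only [hga, sub_zero, pow_one]
    exact hfa.isLittleO.norm_right
  have := Complex.dist_le_mul_div_pow_of_mapsTo_ball_of_isLittleO hgd hgm hgo hx
  rwa [hga, dist_zero_right, dist_eq_norm] at this

/-- A uniform limit of bounded holomorphic functions is complex differentiable. -/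
theorem differentiableAt_of_tendstoUniformlyOn {F : ℕ → E → ℂ} {f : E → ℂ} {a : E} {r M : ℝ}
    (hr : 0 < r) (hd : ∀ n, DifferentiableOn ℂ (F n) (Metric.ball a r))
    (hM : ∀ n, ∀ x ∈ Metric.ball a r, ‖F n x‖ ≤ M)
    (hF : TendstoUniformlyOn F f atTop (Metric.ball a r)) : DifferentiableAt ℂ f a := by
  have hda : ∀ n, DifferentiableAt ℂ (F n) a := fun n =>
    (hd n).differentiableAt (Metric.ball_mem_nhds a hr)
  have hcauchy : CauchySeq fun n => fderiv ℂ (F n) a := by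
    -- The Cauchy estimate is applied to `F m - F n`: two errors `ε * r / 8`, times the factor `2 /
    -- r`, give `ε / 2`.
    refine Metric.cauchySeq_iff.2 fun ε hε => ?_
    obtain ⟨N, hN⟩ := eventually_atTop.1
      (Metric.tendstoUniformlyOn_iff.1 hF (ε * r / 8) (by positivity))
    refine ⟨N, fun m hm n hn => ?_⟩
    rw [dist_eq_norm, ← fderiv_sub (hda m) (hda n)]
    have hb : ∀ x ∈ Metric.ball a r, ‖(F m - F n) x‖ ≤ ε * r / 4 := by
      intro x hx
      have h1 := hN m hm x hx
      have h2 := hN n hn x hx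
      have h3 := dist_triangle_left (F m x) (F n x) (f x)
      rw [dist_eq_norm (F m x)] at h3
      rw [Pi.sub_apply]
      linarith
    have := norm_fderiv_le_of_bounded hr ((hd m).sub (hd n)) hb
    refine this.trans_lt ?_
    have : 2 * (ε * r / 4) / r = ε / 2 := by field_simp; ring
    rw [this]
    linarith
  obtain ⟨A, hA⟩ := cauchySeq_tendsto_of_complete hcauchy
  -- The second order estimate has a constant independent of `n`, so it survives the limit and
  -- identifies `A` as the derivative.
  refine (hasFDerivAt_of_quadratic (A := A) (C := 4 * M / r ^ 2) ?_).differentiableAt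
  filter_upwards [Metric.ball_mem_nhds a hr] with x hx
  have h1 := hF.tendsto_at hx
  have h2 := hF.tendsto_at (Metric.mem_ball_self hr)
  have h3 : Tendsto (fun n => fderiv ℂ (F n) a (x - a)) atTop (𝓝 (A (x - a))) :=
    ((ContinuousLinearMap.apply ℂ ℂ (x - a)).continuous.tendsto A).comp hA
  refine le_of_tendsto ((h1.sub h2).sub h3).norm (Eventually.of_forall fun n => ?_)
  refine (norm_sub_sub_fderiv_le hr (hd n) (hM n) hx).trans_eq ?_
  rw [div_pow]
  ring

/-- The directional derivatives of a bounded holomorphic function are holomorphic. -/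
theorem differentiableAt_fderiv_apply {f : E → ℂ} {a : E} {r M : ℝ} (hr : 0 < r)
    (hd : DifferentiableOn ℂ f (Metric.ball a (2 * r)))
    (hM : ∀ x ∈ Metric.ball a (2 * r), ‖f x‖ ≤ M) (y : E) :
    DifferentiableAt ℂ (fun x => fderiv ℂ f x y) a := by
  have hM0 : 0 ≤ M := (norm_nonneg _).trans (hM a (Metric.mem_ball_self (by positivity)))
  have hsub : ∀ x ∈ Metric.ball a r, Metric.ball x r ⊆ Metric.ball a (2 * r) := by
    intro x hx
    refine Metric.ball_subset_ball' ?_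
    have := Metric.mem_ball.1 hx
    linarith
  -- These steps satisfy `‖t n • y‖ < r`, so difference quotients at points of the ball of radius
  -- `r` use only values in the ball of radius `2 * r`. The second order estimate makes them
  -- converge uniformly to the directional derivative, with error proportional to `t n`.
  set t : ℕ → ℝ := fun n => r / (‖y‖ + 1) / (n + 1) with ht
  have htpos : ∀ n, 0 < t n := fun n => by positivity
  have hty : ∀ n, ‖(t n : ℂ) • y‖ < r := by
    intro n
    rw [norm_smul, Complex.norm_real, Real.norm_of_nonneg (htpos n).le]
    have h1 : t n ≤ r / (‖y‖ + 1) := div_le_self (by positivity) (by simp)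
    calc t n * ‖y‖ ≤ r / (‖y‖ + 1) * ‖y‖ := by gcongr
      _ < r / (‖y‖ + 1) * (‖y‖ + 1) := by gcongr; linarith
      _ = r := by field_simp
  have hmem : ∀ n x, x + (t n : ℂ) • y ∈ Metric.ball x r := by
    intro n x
    simpa [mem_ball_iff_norm] using hty n
  have ht0 : Tendsto t atTop (𝓝 0) :=
    tendsto_const_nhds.div_atTop (tendsto_natCast_atTop_atTop.atTop_add tendsto_const_nhds)
  refine differentiableAt_of_tendstoUniformlyOn (r := r) (M := 2 * M / r * ‖y‖) hr
    (F := fun n x => (t n : ℂ)⁻¹ * (f (x + (t n : ℂ) • y) - f x)) ?_ ?_ ?_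
  · intro n x hx
    have h1 : DifferentiableAt ℂ f (x + (t n : ℂ) • y) :=
      hd.differentiableAt (Metric.isOpen_ball.mem_nhds (hsub x hx (hmem n x)))
    have h2 : DifferentiableAt ℂ f x :=
      hd.differentiableAt (Metric.isOpen_ball.mem_nhds (hsub x hx (Metric.mem_ball_self hr)))
    have h3 : DifferentiableAt ℂ (fun x => f (x + (t n : ℂ) • y)) x :=
      DifferentiableAt.comp x h1 (by fun_prop)
    exact ((h3.sub h2).const_mul _).differentiableWithinAt
  · intro n x hx
    have h1 := norm_sub_le_of_bounded hr (hd.mono (hsub x hx))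
      (fun z hz => hM z (hsub x hx hz)) (hmem n x)
    rw [add_sub_cancel_left, norm_smul, Complex.norm_real, Real.norm_of_nonneg (htpos n).le] at h1
    rw [norm_mul, norm_inv, Complex.norm_real, Real.norm_of_nonneg (htpos n).le,
      inv_mul_le_iff₀ (htpos n)]
    linarith
  · rw [Metric.tendstoUniformlyOn_iff]
    intro ε hε
    have h0 : Tendsto (fun n => t n * (4 * M * ‖y‖ ^ 2 / r ^ 2)) atTop (𝓝 0) := by
      simpa using ht0.mul_const (4 * M * ‖y‖ ^ 2 / r ^ 2)
    filter_upwards [h0.eventually_lt_const hε] with n hn x hx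
    refine lt_of_le_of_lt ?_ hn
    have h1 := norm_sub_sub_fderiv_le hr (hd.mono (hsub x hx))
      (fun z hz => hM z (hsub x hx hz)) (hmem n x)
    rw [add_sub_cancel_left, norm_smul, Complex.norm_real, Real.norm_of_nonneg (htpos n).le,
      map_smul, smul_eq_mul] at h1
    have htn : (t n : ℂ) ≠ 0 := by exact_mod_cast (htpos n).ne'
    have h2 : (t n : ℂ)⁻¹ * (f (x + (t n : ℂ) • y) - f x) - fderiv ℂ f x y =
        (t n : ℂ)⁻¹ * (f (x + (t n : ℂ) • y) - f x - t n * fderiv ℂ f x y) := by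
      field_simp
    rw [dist_comm, dist_eq_norm, h2, norm_mul, norm_inv, Complex.norm_real,
      Real.norm_of_nonneg (htpos n).le, inv_mul_le_iff₀ (htpos n)]
    refine h1.trans_eq ?_
    field_simp

end Cauchy

/-! ### The function spaces and their preduals -/

/-- Operators on a subspace are determined by their values on a family with dense span. -/
theorem subspace_hom_ext {W G B : Type*} [NormedAddCommGroup W] [NormedSpace ℂ W]
    [NormedAddCommGroup G] [NormedSpace ℂ G] (p : Submodule ℂ W) (d : B → p)
    (hd : ∀ w ∈ p, w ∈ (Submodule.span ℂ (Set.range fun x => (d x : W))).topologicalClosure)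
    {S T : p →L[ℂ] G} (h : ∀ x, S (d x) = T (d x)) : S = T := by
  have hdense : Dense (Submodule.span ℂ (Set.range d) : Set p) := by
    refine Subtype.dense_iff.2 fun w hw => ?_
    have h1 := hd w hw
    have h2 : Set.range (fun x => (d x : W)) = p.subtype '' Set.range d := by
      rw [← Set.range_comp]
      rfl
    rw [← SetLike.mem_coe, Submodule.topologicalClosure_coe, h2, ← Submodule.map_span] at h1
    exact h1
  refine ContinuousLinearMap.ext_on hdense ?_
  rintro _ ⟨x, rfl⟩
  exact h x

/-- A continuous operator that maps the elements of a set into a closed subspace maps the closed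
span of the set into this subspace. -/
theorem map_mem_of_mem_closure_span {V W : Type*} [NormedAddCommGroup V] [NormedSpace ℂ V]
    [NormedAddCommGroup W] [NormedSpace ℂ W] (Φ : V →L[ℂ] W) {s : Set V} {p : Submodule ℂ W}
    (hp : IsClosed (p : Set W)) (h : ∀ v ∈ s, Φ v ∈ p) {v : V}
    (hv : v ∈ (Submodule.span ℂ s).topologicalClosure) : Φ v ∈ p := by
  have : (Submodule.span ℂ s).topologicalClosure ≤ p.comap (Φ : V →ₗ[ℂ] W) :=
    Submodule.topologicalClosure_minimal _ (Submodule.span_le.2 h) (hp.preimage Φ.continuous)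
  exact this hv

section Metric

variable {X : Type*} [NormedAddCommGroup X]

instance : CompleteSpace (LipFree X) :=
  (Submodule.isClosed_topologicalClosure _).completeSpace_coe

theorem one_sub_norm_pos (x : UBall X) : 0 < 1 - ‖(x : X)‖ :=
  sub_pos.2 (mem_ball_zero_iff.1 x.2)

theorem ball_subset_unitBall {x : X} {r : ℝ} (h : r ≤ 1 - ‖x‖) :
    Metric.ball x r ⊆ Metric.ball (0 : X) 1 := by
  refine Metric.ball_subset_ball' ?_
  rw [dist_zero_right]
  linarith

theorem norm_extend_le {f : UBall X → ℂ} {M : ℝ} (hM : ∀ x, ‖f x‖ ≤ M) {x : X}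
    (hx : x ∈ Metric.ball (0 : X) 1) : ‖extend f x‖ ≤ M := by
  rw [show extend f x = f ⟨x, hx⟩ from extend_coe f ⟨x, hx⟩]
  exact hM _

theorem extend_eventuallyEq {f : UBall X → ℂ} {g : X → ℂ} (h : ∀ x : UBall X, f x = g x)
    (x : UBall X) : extend f =ᶠ[𝓝 (x : X)] g := by
  filter_upwards [Metric.isOpen_ball.mem_nhds x.2] with z hz
  exact (extend_coe f ⟨z, hz⟩).trans (h _)

variable (X) in
/-- The inclusion of `F(B_X)` into `Lip₀(B_X)*`. -/
def LipFree.toDualₗᵢ : LipFree X →ₗᵢ[ℂ] StrongDual ℂ (Lip0 X) :=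
  (lipFreeSubmodule X).subtypeₗᵢ

theorem LipFree.hom_ext {G : Type*} [NormedAddCommGroup G] [NormedSpace ℂ G]
    {S T : LipFree X →L[ℂ] G} (h : ∀ x, S (deltaF x) = T (deltaF x)) : S = T :=
  subspace_hom_ext (lipFreeSubmodule X) deltaF (fun _ hw => hw) h

theorem norm_deltaF_sub_le (x y : UBall X) : ‖deltaF x - deltaF y‖ ≤ ‖(x : X) - y‖ := by
  refine ContinuousLinearMap.opNorm_le_bound (evalLip x - evalLip y) (norm_nonneg _) fun f => ?_
  rw [mul_comm]
  exact f.norm_sub_le x y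

end Metric

section Spaces

variable {X : Type*} [NormedAddCommGroup X] [NormedSpace ℂ X]

instance : CompleteSpace (G0 X) :=
  (isClosed_ballContinuousDual (HL0.toContinuousMap X)).completeSpace_coe

instance : CompleteSpace (GInf X) :=
  (isClosed_ballContinuousDual (HInf.toContinuousMap X)).completeSpace_coe

theorem Holo.continuous {f : UBall X → ℂ} (hf : Holo f) : Continuous f := by
  have h := continuousOn_iff_continuous_domRestrict.1 (DifferentiableOn.continuousOn hf)
  have h1 : f = (Metric.ball (0 : X) 1).domRestrict (extend f) :=
    funext fun x => (extend_coe f x).symm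
  rw [h1]
  exact h

/-- A function that extends to a complex differentiable function is holomorphic. -/
theorem Holo.of_differentiableAt {f : UBall X → ℂ} {g : X → ℂ} (h : ∀ x : UBall X, f x = g x)
    (hg : ∀ x : UBall X, DifferentiableAt ℂ g x) : Holo f := by
  intro x hx
  refine (hg ⟨x, hx⟩).differentiableWithinAt.congr (fun z hz => ?_) ?_
  · exact (extend_coe f ⟨z, hz⟩).trans (h _)
  · exact (extend_coe f ⟨x, hx⟩).trans (h _)

theorem differential_eq {f : UBall X → ℂ} {g : X → ℂ} (h : ∀ x : UBall X, f x = g x)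
    (x : UBall X) : differential f x = fderiv ℂ g x :=
  (extend_eventuallyEq h x).fderiv_eq

/-- A bounded holomorphic function as an element of `H^∞(B_X)`. -/
def HInf.ofHolo (f : UBall X → ℂ) (hf : Holo f) (C : ℝ) (hC : ∀ x, ‖f x‖ ≤ C) : HInf X :=
  ⟨BoundedContinuousFunction.ofNormedAddCommGroup f hf.continuous C hC, hf⟩

theorem HInf.ext {f g : HInf X} (h : ∀ x, f.toBCF x = g.toBCF x) : f = g :=
  Subtype.ext (BoundedContinuousFunction.ext h)

theorem HInf.norm_apply_le (f : HInf X) (x : UBall X) : ‖f.toBCF x‖ ≤ ‖f‖ :=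
  f.toBCF.norm_coe_le_norm x

theorem HInf.norm_le_of (f : HInf X) {C : ℝ} (hC : 0 ≤ C) (h : ∀ x, ‖f.toBCF x‖ ≤ C) :
    ‖f‖ ≤ C :=
  (BoundedContinuousFunction.norm_le hC).2 h

theorem HInf.holo (f : HInf X) : Holo (f.toBCF : UBall X → ℂ) := f.2

/-- A holomorphic Lipschitz function that vanishes at `0` as an element of `HL₀(B_X)`. -/
def HL0.ofHolo (f : UBall X → ℂ) (hf : Holo f) (C : ℝ)
    (hC : ∀ x y, ‖f x - f y‖ ≤ C * ‖(x : X) - y‖) (h0 : f (origin X) = 0) : HL0 X :=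
  ⟨⟨f, ⟨C, hC⟩, h0⟩, BoundedContinuousFunction.ofNormedAddCommGroup f hf.continuous |C| fun x => by
    have h1 := hC x (origin X)
    rw [h0, sub_zero] at h1
    refine h1.trans ?_
    have h2 : ‖(x : X) - (origin X : X)‖ ≤ 1 := by
      rw [show ((origin X : X)) = 0 from rfl, sub_zero]
      exact (mem_ball_zero_iff.1 x.2).le
    calc C * ‖(x : X) - (origin X : X)‖ ≤ |C| * 1 :=
          mul_le_mul (le_abs_self C) h2 (norm_nonneg _) (abs_nonneg _)
      _ = |C| := mul_one _, hf, rfl⟩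

theorem HL0.norm_apply_le (f : HL0 X) (x : UBall X) : ‖f.toLip.toFun x‖ ≤ ‖f‖ := by
  refine (f.toLip.norm_apply_le x).trans ?_
  rw [f.norm_toLip]
  exact mul_le_of_le_one_right (norm_nonneg _) (mem_ball_zero_iff.1 x.2).le

/-- The mean value inequality: `L(f) ≤ sup ‖df(x)‖`. -/
theorem HL0.norm_le_of_differential (f : HL0 X) {C : ℝ} (hC : 0 ≤ C)
    (h : ∀ x y, ‖differential f.toLip.toFun x y‖ ≤ C * ‖y‖) : ‖f‖ ≤ C := by
  refine f.toLip.norm_le_of hC fun x y => ?_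
  have := (convex_ball (0 : X) 1).norm_image_sub_le_of_norm_fderiv_le (𝕜 := ℂ)
    (f := extend f.toLip.toFun) (C := C) (fun z hz => f.holo.differentiableAt ⟨z, hz⟩)
    (fun z hz => ContinuousLinearMap.opNorm_le_bound _ hC (h ⟨z, hz⟩)) y.2 x.2
  rwa [extend_coe, extend_coe] at this

variable (X) in
/-- The inclusion of `HL₀(B_X)` into `Lip₀(B_X)` as a bounded operator. -/
def HL0.toLipL : HL0 X →L[ℂ] Lip0 X := (hl0Submodule X).subtypeL

variable (X) in
/-- The inclusion of `G₀(B_X)` into `HL₀(B_X)*`. -/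
def G0.toDualₗᵢ : G0 X →ₗᵢ[ℂ] StrongDual ℂ (HL0 X) :=
  (ballContinuousDual (HL0.toContinuousMap X)).subtypeₗᵢ

variable (X) in
/-- The inclusion of `G^∞(B_X)` into `H^∞(B_X)*`. -/
def GInf.toDualₗᵢ : GInf X →ₗᵢ[ℂ] StrongDual ℂ (HInf X) :=
  (ballContinuousDual (HInf.toContinuousMap X)).subtypeₗᵢ

theorem G0.ext {φ ψ : G0 X} (h : ∀ f, φ.toDual f = ψ.toDual f) : φ = ψ :=
  Subtype.ext (ContinuousLinearMap.ext h)

/-! ### Density of the evaluations -/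

/-- The unit ball of `HL0 X` consists of 1-Lipschitz functions, hence is equicontinuous. -/
theorem G0.mem_closure_span (φ : G0 X) :
    φ.toDual ∈ (Submodule.span ℂ (Set.range (evalHL (X := X)))).topologicalClosure := by
  refine mem_closure_span_of_equicontinuous (HL0.toContinuousMap X) evalHL (fun _ _ => rfl)
    (fun x ε hε => ⟨Metric.ball x ε, Metric.ball_mem_nhds x hε, fun y hy f hf => ?_⟩) φ.2
  have h1 := f.toLip.norm_sub_le y x
  rw [f.norm_toLip] at h1
  rw [Metric.mem_ball, Subtype.dist_eq, dist_eq_norm] at hy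
  refine h1.trans_lt (lt_of_le_of_lt ?_ hy)
  exact mul_le_of_le_one_left (norm_nonneg _) hf

/-- Equicontinuity at `x` comes from the Cauchy estimate on the ball of radius `1 - ‖x‖`, which
bounds increments by `2 / (1 - ‖x‖)` times the distance, uniformly over the unit ball of `HInf X`.
-/
theorem GInf.mem_closure_span (φ : GInf X) :
    φ.toDual ∈ (Submodule.span ℂ (Set.range (evalInf (X := X)))).topologicalClosure := by
  refine mem_closure_span_of_equicontinuous (HInf.toContinuousMap X) evalInf (fun _ _ => rfl)
    (fun x ε hε => ?_) φ.2
  set r := 1 - ‖(x : X)‖ with hr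
  have hr0 : 0 < r := one_sub_norm_pos x
  refine ⟨Metric.ball x (min r (ε * r / 2)), Metric.ball_mem_nhds x (by positivity),
    fun y hy f hf => ?_⟩
  rw [Metric.mem_ball, Subtype.dist_eq, lt_min_iff] at hy
  have hsub : Metric.ball (x : X) r ⊆ Metric.ball (0 : X) 1 := ball_subset_unitBall le_rfl
  have h1 := norm_sub_le_of_bounded hr0 (DifferentiableOn.mono f.holo hsub)
    (fun z hz => norm_extend_le (fun w => (f.norm_apply_le w).trans hf) (hsub hz))
    (Metric.mem_ball.2 hy.1)
  rw [extend_coe, extend_coe, ← dist_eq_norm (y : X)] at h1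
  refine h1.trans_lt ?_
  calc 2 * 1 / r * dist (y : X) x < 2 * 1 / r * (ε * r / 2) := by
        gcongr
        exact hy.2
    _ = ε := by field_simp

theorem G0.hom_ext {G : Type*} [NormedAddCommGroup G] [NormedSpace ℂ G] {S T : G0 X →L[ℂ] G}
    (h : ∀ x, S (delta0 x) = T (delta0 x)) : S = T :=
  subspace_hom_ext (ballContinuousDual (HL0.toContinuousMap X)) delta0
    (fun w hw => G0.mem_closure_span ⟨w, hw⟩) h

theorem GInf.hom_ext {G : Type*} [NormedAddCommGroup G] [NormedSpace ℂ G]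
    {S T : GInf X →L[ℂ] G} (h : ∀ x, S (deltaInf x) = T (deltaInf x)) : S = T :=
  subspace_hom_ext (ballContinuousDual (HInf.toContinuousMap X)) deltaInf
    (fun w hw => GInf.mem_closure_span ⟨w, hw⟩) h

/-! ### The derivative of `δ` -/

/-- The second order Cauchy estimate is uniform over the unit ball of `HL0 X`, whose members are
bounded by 1. Hence `δ` is differentiable in norm. -/
theorem norm_evalHL_sub_sub_evalDeriv_le (x z : UBall X)
    (hz : ‖(z : X) - x‖ < 1 - ‖(x : X)‖) :
    ‖evalHL z - evalHL x - evalDeriv x ((z : X) - x)‖ ≤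
      4 * (‖(z : X) - x‖ / (1 - ‖(x : X)‖)) ^ 2 := by
  refine ContinuousLinearMap.opNorm_le_bound _ (by positivity) fun f => ?_
  have hsub : Metric.ball (x : X) (1 - ‖(x : X)‖) ⊆ Metric.ball (0 : X) 1 :=
    ball_subset_unitBall le_rfl
  have h1 := norm_sub_sub_fderiv_le (one_sub_norm_pos x) (DifferentiableOn.mono f.holo hsub)
    (fun w hw => norm_extend_le f.norm_apply_le (hsub hw)) (mem_ball_iff_norm.2 hz)
  rw [extend_coe, extend_coe] at h1
  refine h1.trans_eq ?_
  ring

/-- Difference quotients of evaluations along `y` converge in norm to `e_{x,y}`, and the subspace is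
closed. -/
theorem evalDeriv_mem (x : UBall X) (y : X) :
    evalDeriv x y ∈ ballContinuousDual (HL0.toContinuousMap X) := by
  rw [← SetLike.mem_coe, ← (isClosed_ballContinuousDual (HL0.toContinuousMap X)).closure_eq,
    Metric.mem_closure_iff]
  intro ε hε
  have hr0 : 0 < 1 - ‖(x : X)‖ := one_sub_norm_pos x
  have h1 : Tendsto (fun t : ℝ => t * ‖y‖) (𝓝[>] 0) (𝓝 0) := by
    have : Tendsto (fun t : ℝ => t * ‖y‖) (𝓝 0) (𝓝 (0 * ‖y‖)) := tendsto_id.mul_const _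
    rw [zero_mul] at this
    exact this.mono_left nhdsWithin_le_nhds
  have h2 : Tendsto (fun t : ℝ => t * (4 * (‖y‖ / (1 - ‖(x : X)‖)) ^ 2)) (𝓝[>] 0) (𝓝 0) := by
    have : Tendsto (fun t : ℝ => t * (4 * (‖y‖ / (1 - ‖(x : X)‖)) ^ 2)) (𝓝 0)
        (𝓝 (0 * _)) := tendsto_id.mul_const _
    rw [zero_mul] at this
    exact this.mono_left nhdsWithin_le_nhds
  obtain ⟨t, ht1, ht2, ht0⟩ := ((h1.eventually_lt_const hr0).and
    ((h2.eventually_lt_const hε).and self_mem_nhdsWithin)).exists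
  have hnt : ‖(t : ℂ)‖ = t := by rw [Complex.norm_real, Real.norm_of_nonneg ht0.le]
  have hty : ‖(t : ℂ) • y‖ = t * ‖y‖ := by rw [norm_smul, hnt]
  have hmem : (x : X) + (t : ℂ) • y ∈ Metric.ball (0 : X) 1 := by
    rw [mem_ball_zero_iff]
    have := norm_add_le (x : X) ((t : ℂ) • y)
    linarith
  set z : UBall X := ⟨(x : X) + (t : ℂ) • y, hmem⟩ with hzdef
  have hzx : (z : X) - x = (t : ℂ) • y := add_sub_cancel_left _ _
  refine ⟨(t : ℂ)⁻¹ • (evalHL z - evalHL x),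
    Submodule.smul_mem _ _ (Submodule.sub_mem _ (delta0 z).2 (delta0 x).2), ?_⟩
  have h3 := norm_evalHL_sub_sub_evalDeriv_le x z (by rw [hzx, hty]; exact ht1)
  have h4 : evalDeriv x ((z : X) - x) = (t : ℂ) • evalDeriv x y := by
    rw [hzx]
    exact ContinuousLinearMap.ext fun f => map_smul (differential f.toLip.toFun x) _ _
  have htc : (t : ℂ) ≠ 0 := by exact_mod_cast ht0.ne'
  have h5 : (t : ℂ)⁻¹ • (evalHL z - evalHL x) - evalDeriv x y =
      (t : ℂ)⁻¹ • (evalHL z - evalHL x - evalDeriv x ((z : X) - x)) := by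
    rw [h4, smul_sub _ (evalHL z - evalHL x), inv_smul_smul₀ htc]
  rw [dist_comm, dist_eq_norm, h5, norm_smul, norm_inv, hnt]
  refine lt_of_le_of_lt ?_ ht2
  rw [inv_mul_le_iff₀ ht0]
  refine h3.trans_eq ?_
  rw [hzx, hty]
  ring

/-- The functional `e_{x,y}` as an element of `G₀(B_X)`. -/
def deriv0 (x : UBall X) (y : X) : G0 X := ⟨evalDeriv x y, evalDeriv_mem x y⟩

theorem norm_deriv0_le (x : UBall X) (y : X) : ‖deriv0 x y‖ ≤ ‖y‖ := by
  refine ContinuousLinearMap.opNorm_le_bound (evalDeriv x y) (norm_nonneg _) fun f => ?_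
  refine ((differential f.toLip.toFun x).le_opNorm y).trans ?_
  rw [mul_comm]
  exact mul_le_mul_of_nonneg_left (norm_differential_le f.toLip x) (norm_nonneg _)

theorem norm_delta0_sub_le (x y : UBall X) : ‖delta0 x - delta0 y‖ ≤ ‖(x : X) - y‖ := by
  refine ContinuousLinearMap.opNorm_le_bound (evalHL x - evalHL y) (norm_nonneg _) fun f => ?_
  rw [mul_comm]
  exact f.toLip.norm_sub_le x y

theorem norm_deltaInf_le (x : UBall X) : ‖deltaInf x‖ ≤ 1 :=
  ContinuousLinearMap.opNorm_le_bound (evalInf x) zero_le_one fun f =>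
    (f.norm_apply_le x).trans_eq (one_mul _).symm

/-- The differential at `x` of `x ↦ φ (δ x)`. -/
def derivFunctional (φ : StrongDual ℂ (G0 X)) (x : UBall X) : X →L[ℂ] ℂ :=
  LinearMap.mkContinuous
    { toFun := fun y => φ (deriv0 x y)
      map_add' := fun y y' => by
        rw [← map_add]
        congr 1
        exact G0.ext fun f => map_add (differential f.toLip.toFun x) y y'
      map_smul' := fun c y => by
        rw [RingHom.id_apply, ← map_smul]
        congr 1
        exact G0.ext fun f => map_smul (differential f.toLip.toFun x) c y } ‖φ‖
    fun y => (φ.le_opNorm _).trans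
      (mul_le_mul_of_nonneg_left (norm_deriv0_le x y) (norm_nonneg _))

/-- Applying `φ` to the quadratic estimate for `δ` costs only the factor `‖φ‖`. This makes the
function representing `φ` holomorphic. -/
theorem hasFDerivAt_functional (φ : StrongDual ℂ (G0 X)) (x : UBall X) :
    HasFDerivAt (extend fun z => φ (delta0 z)) (derivFunctional φ x) x := by
  refine hasFDerivAt_of_quadratic (C := ‖φ‖ * (4 / (1 - ‖(x : X)‖) ^ 2)) ?_
  filter_upwards [Metric.ball_mem_nhds (x : X) (one_sub_norm_pos x)] with z hz
  obtain ⟨z, rfl⟩ : ∃ w : UBall X, (w : X) = z := ⟨⟨z, ball_subset_unitBall le_rfl hz⟩, rfl⟩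
  rw [extend_coe, extend_coe]
  have h1 : φ (delta0 z) - φ (delta0 x) - derivFunctional φ x ((z : X) - x) =
      φ (delta0 z - delta0 x - deriv0 x ((z : X) - x)) := by
    rw [map_sub φ, map_sub φ]
    rfl
  rw [h1]
  refine (φ.le_opNorm _).trans ?_
  rw [mul_assoc]
  refine mul_le_mul_of_nonneg_left ?_ (norm_nonneg _)
  refine (norm_evalHL_sub_sub_evalDeriv_le x z (mem_ball_iff_norm.1 hz)).trans_eq ?_
  rw [div_pow]
  ring

/-- The element of `HL₀(B_X)` that represents a functional on `G₀(B_X)`. -/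
def HL0.ofDual (φ : StrongDual ℂ (G0 X)) : HL0 X :=
  HL0.ofHolo (fun z => φ (delta0 z))
    (fun x hx => (hasFDerivAt_functional φ ⟨x, hx⟩).differentiableAt.differentiableWithinAt) ‖φ‖
    (fun x y => by
      rw [← map_sub]
      exact (φ.le_opNorm _).trans
        (mul_le_mul_of_nonneg_left (norm_delta0_sub_le x y) (norm_nonneg _)))
    (by
      have : delta0 (origin X) = 0 := G0.ext fun f => f.toLip.map_origin
      rw [this, map_zero])

theorem HL0.differential_ofDual (φ : StrongDual ℂ (G0 X)) (x : UBall X) (y : X) :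
    differential (HL0.ofDual φ).toLip.toFun x y = φ (deriv0 x y) := by
  have h : differential (HL0.ofDual φ).toLip.toFun x = derivFunctional φ x :=
    (hasFDerivAt_functional φ x).fderiv
  rw [h]
  rfl

/-- Every functional on `G₀(B_X)` is the evaluation at an element of `HL₀(B_X)`. -/
theorem HL0.apply_ofDual (φ : StrongDual ℂ (G0 X)) (u : G0 X) :
    u.toDual (HL0.ofDual φ) = φ u := by
  -- Both functionals agree on the evaluations, whose span is dense in `G0 X`.
  have h : (ContinuousLinearMap.apply ℂ ℂ (HL0.ofDual φ)).comp
      (G0.toDualₗᵢ X).toContinuousLinearMap = φ := G0.hom_ext fun _ => rfl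
  exact congrArg (fun T : G0 X →L[ℂ] ℂ => T u) h

/-- This reduces the norm condition on a transpose to a bound on the Lipschitz constant of the
representing function. -/
theorem HL0.norm_le_norm_ofDual (φ : StrongDual ℂ (G0 X)) : ‖φ‖ ≤ ‖HL0.ofDual φ‖ := by
  refine ContinuousLinearMap.opNorm_le_bound _ (norm_nonneg _) fun u => ?_
  rw [← HL0.apply_ofDual, mul_comm]
  exact u.toDual.le_opNorm _

/-! ### The operator `π` -/

variable (X) in
/-- The restriction of functionals from `Lip₀(B_X)` to `HL₀(B_X)`, on the free space. -/
def restrictFree : LipFree X →L[ℂ] G0 X :=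
  (((ContinuousLinearMap.compL ℂ (HL0 X) (Lip0 X) ℂ).flip (HL0.toLipL X)).comp
    (LipFree.toDualₗᵢ X).toContinuousLinearMap).codRestrict
      (ballContinuousDual (HL0.toContinuousMap X)) fun μ => by
    -- Restriction is norm continuous and sends the generators `δ x` of the free space into the
    -- closed subspace `G0 X`.
    refine map_mem_of_mem_closure_span
      ((ContinuousLinearMap.compL ℂ (HL0 X) (Lip0 X) ℂ).flip (HL0.toLipL X))
      (isClosed_ballContinuousDual _) ?_ μ.2
    rintro _ ⟨x, rfl⟩
    exact (delta0 x).2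

theorem restrictFree_deltaF (x : UBall X) : restrictFree X (deltaF x) = delta0 x := rfl

theorem norm_restrictFree_apply_le (μ : LipFree X) : ‖restrictFree X μ‖ ≤ ‖μ‖ :=
  ContinuousLinearMap.opNorm_le_bound _ (norm_nonneg _) fun f => μ.toDual.le_opNorm f.toLip

/-- The increments of the function representing `φ` are the values of `φ ∘ π` on `δ x - δ y`, a
vector of norm at most `‖x - y‖`; so its Lipschitz constant is at most `‖φ ∘ π‖`. -/
theorem isQuotientOperator_restrictFree : IsQuotientOperator (restrictFree X) := by
  refine isQuotientOperator_of_dual _ norm_restrictFree_apply_le fun φ => ?_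
  refine (HL0.norm_le_norm_ofDual φ).trans
    ((HL0.ofDual φ).toLip.norm_le_of (norm_nonneg _) fun x y => ?_)
  have h : (HL0.ofDual φ).toLip.toFun x - (HL0.ofDual φ).toLip.toFun y =
      φ.comp (restrictFree X) (deltaF x - deltaF y) := by
    rw [map_sub]
    rfl
  rw [h]
  exact (ContinuousLinearMap.le_opNorm _ _).trans
    (mul_le_mul_of_nonneg_left (norm_deltaF_sub_le x y) (norm_nonneg _))

theorem ker_restrictFree :
    LinearMap.ker (restrictFree X : LipFree X →ₗ[ℂ] G0 X) = HL0perp X := by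
  ext μ
  rw [LinearMap.mem_ker]
  constructor
  · intro h f
    exact congrArg (fun u : G0 X => u.toDual f) h
  · intro h
    exact G0.ext h

end Spaces

/-- A quotient operator induces an isometric isomorphism on the quotient by its kernel. -/
theorem IsQuotientOperator.exists_quotient_equiv {E F : Type*} [NormedAddCommGroup E]
    [NormedSpace ℂ E] [NormedAddCommGroup F] [NormedSpace ℂ F] {T : E →L[ℂ] F}
    (hT : IsQuotientOperator T) {p : Submodule ℂ E} (hp : LinearMap.ker (T : E →ₗ[ℂ] F) = p) :
    ∃ e : (E ⧸ p) ≃ₗᵢ[ℂ] F, ∀ u : E, e (Submodule.Quotient.mk u) = T u := by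
  subst hp
  refine ⟨⟨(T : E →ₗ[ℂ] F).quotKerEquivOfSurjective hT.1, fun v => ?_⟩, fun u => rfl⟩
  obtain ⟨u, rfl⟩ := Submodule.Quotient.mk_surjective _ v
  change ‖T u‖ = _
  -- The coset of `u` is the fibre of `T` over `T u`, so both norms are the same infimum.
  refine le_antisymm (le_of_forall_pos_lt_add fun ε hε => ?_) ((hT.2 (T u)).2 ?_)
  · obtain ⟨w, hw, hlt⟩ := Submodule.Quotient.norm_mk_lt (Submodule.Quotient.mk u :
      E ⧸ LinearMap.ker (T : E →ₗ[ℂ] F)) hε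
    refine lt_of_le_of_lt ((hT.2 (T u)).1 ⟨w, ?_, rfl⟩) hlt
    have := (Submodule.Quotient.eq _).1 hw
    rw [LinearMap.mem_ker, map_sub, sub_eq_zero] at this
    exact this
  · rintro _ ⟨w, hw, rfl⟩
    have : (Submodule.Quotient.mk u : E ⧸ LinearMap.ker (T : E →ₗ[ℂ] F)) =
        Submodule.Quotient.mk w := by
      rw [Submodule.Quotient.eq, LinearMap.mem_ker, map_sub, sub_eq_zero]
      exact hw.symm
    rw [this]
    exact Submodule.Quotient.norm_mk_le _ w

/-! ### The operator `Ψ` -/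

section Psi

variable {X : Type*} [NormedAddCommGroup X] [NormedSpace ℂ X]

theorem HL0.norm_differential_apply_le (f : HL0 X) (x : UBall X) (y : X) :
    ‖differential f.toLip.toFun x y‖ ≤ ‖f‖ * ‖y‖ :=
  ((differential f.toLip.toFun x).le_opNorm y).trans
    (mul_le_mul_of_nonneg_right (norm_differential_le f.toLip x) (norm_nonneg _))

theorem HL0.holo_differential (f : HL0 X) (y : X) :
    Holo fun x => differential f.toLip.toFun x y := by
  refine Holo.of_differentiableAt (g := fun x => fderiv ℂ (extend f.toLip.toFun) x y)
    (fun _ => rfl) fun x => ?_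
  have hr0 := one_sub_norm_pos x
  -- The local statement with radius `r` needs a bound on the ball of radius `2 * r`; hence `r` is
  -- half of `1 - ‖x‖`.
  have hsub : Metric.ball (x : X) (2 * ((1 - ‖(x : X)‖) / 2)) ⊆ Metric.ball (0 : X) 1 :=
    ball_subset_unitBall (by linarith)
  exact differentiableAt_fderiv_apply (half_pos hr0) (DifferentiableOn.mono f.holo hsub)
    (fun z hz => norm_extend_le f.norm_apply_le (hsub hz)) y

/-- The directional derivative `f ↦ df(·)(y)` from `HL₀(B_X)` to `H^∞(B_X)`. -/
def dirDeriv (y : X) : HL0 X →L[ℂ] HInf X :=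
  LinearMap.mkContinuous
    { toFun := fun f => HInf.ofHolo (fun x => differential f.toLip.toFun x y)
        (f.holo_differential y) (‖f‖ * ‖y‖) fun x => f.norm_differential_apply_le x y
      map_add' := fun f g => HInf.ext fun x => map_add (evalDeriv x y) f g
      map_smul' := fun c f => HInf.ext fun x => map_smul (evalDeriv x y) c f } ‖y‖
    fun f => by
      rw [mul_comm]
      exact HInf.norm_le_of _ (by positivity) fun x => f.norm_differential_apply_le x y

theorem dirDeriv_apply (y : X) (f : HL0 X) (x : UBall X) :
    (dirDeriv y f).toBCF x = differential f.toLip.toFun x y := rfl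

theorem norm_dirDeriv_apply_le (y : X) (f : HL0 X) : ‖dirDeriv y f‖ ≤ ‖f‖ * ‖y‖ :=
  HInf.norm_le_of _ (by positivity) fun x => f.norm_differential_apply_le x y

/-- Composition with `dirDeriv y` is norm continuous and sends evaluation at `x` to `e_{x,y}`; the
evaluations span `GInf X` densely. -/
theorem comp_dirDeriv_mem (φ : GInf X) (y : X) :
    φ.toDual.comp (dirDeriv y) ∈ ballContinuousDual (HL0.toContinuousMap X) := by
  refine map_mem_of_mem_closure_span
    ((ContinuousLinearMap.compL ℂ (HL0 X) (HInf X) ℂ).flip (dirDeriv y))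
    (isClosed_ballContinuousDual _) ?_ φ.mem_closure_span
  rintro _ ⟨x, rfl⟩
  exact evalDeriv_mem x y

variable (X) in
/-- The bilinear map `(φ, y) ↦ (f ↦ φ(df(·)(y)))`. -/
def psiBilin : GInf X →L[ℂ] X →L[ℂ] G0 X :=
  LinearMap.mkContinuous₂
    (LinearMap.mk₂ ℂ (fun φ y => (⟨φ.toDual.comp (dirDeriv y), comp_dirDeriv_mem φ y⟩ : G0 X))
      (fun _ _ _ => rfl) (fun _ _ _ => rfl)
      (fun φ y z => G0.ext fun f => by
        have h : dirDeriv (y + z) f = dirDeriv y f + dirDeriv z f :=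
          HInf.ext fun x => map_add (differential f.toLip.toFun x) y z
        change φ.toDual (dirDeriv (y + z) f) = φ.toDual (dirDeriv y f) + φ.toDual (dirDeriv z f)
        rw [h, map_add])
      (fun c φ y => G0.ext fun f => by
        have h : dirDeriv (c • y) f = c • dirDeriv y f :=
          HInf.ext fun x => map_smul (differential f.toLip.toFun x) c y
        change φ.toDual (dirDeriv (c • y) f) = c • φ.toDual (dirDeriv y f)
        rw [h, map_smul])) 1
    fun φ y => by
      refine ContinuousLinearMap.opNorm_le_bound (φ.toDual.comp (dirDeriv y)) (by positivity)
        fun f => ?_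
      calc ‖φ.toDual (dirDeriv y f)‖ ≤ ‖φ‖ * ‖dirDeriv y f‖ := φ.toDual.le_opNorm _
        _ ≤ ‖φ‖ * (‖f‖ * ‖y‖) := by gcongr; exact norm_dirDeriv_apply_le y f
        _ = 1 * ‖φ‖ * ‖y‖ * ‖f‖ := by ring

theorem psiBilin_apply (φ : GInf X) (y : X) (f : HL0 X) :
    (psiBilin X φ y).toDual f = φ.toDual (dirDeriv y f) := rfl

variable (X) in
/-- The operator `Ψ` from the completed projective tensor product to `G₀(B_X)`. -/
def psi : ProjTensor (GInf X) X →L[ℂ] G0 X := ProjTensor.lift (psiBilin X)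

theorem psi_ptmul (φ : GInf X) (y : X) : psi X (ptmul φ y) = psiBilin X φ y :=
  ProjTensor.lift_ptmul _ _ _

theorem psi_ptmul_deltaInf (x : UBall X) (y : X) :
    psi X (ptmul (deltaInf x) y) = deriv0 x y :=
  psi_ptmul _ _

theorem norm_psi_apply_le (u : ProjTensor (GInf X) X) : ‖psi X u‖ ≤ ‖u‖ := by
  refine (ProjTensor.norm_lift_apply_le _ u).trans (mul_le_of_le_one_left (norm_nonneg _) ?_)
  exact LinearMap.mkContinuous₂_norm_le _ zero_le_one _

/-- For fixed `y` both operators are bounded in the first factor, where the evaluations have dense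
span. This gives uniqueness of `Ψ`. -/
theorem projTensor_hom_ext {G : Type*} [NormedAddCommGroup G] [NormedSpace ℂ G]
    {S T : ProjTensor (GInf X) X →L[ℂ] G}
    (h : ∀ x y, S (ptmul (deltaInf x) y) = T (ptmul (deltaInf x) y)) : S = T := by
  refine ProjTensor.ext fun φ y => ?_
  have : S.comp ((ptmulL (GInf X) X).flip y) = T.comp ((ptmulL (GInf X) X).flip y) :=
    GInf.hom_ext fun x => h x y
  exact congrArg (fun R : GInf X →L[ℂ] G => R φ) this

/-- The differential of the function representing `φ` takes the values of `φ ∘ Ψ` on the tensors `δ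
x ⊗ y`, which have norm at most `‖y‖`. The mean value inequality turns this into a bound on the
Lipschitz constant. -/
theorem isQuotientOperator_psi : IsQuotientOperator (psi X) := by
  refine isQuotientOperator_of_dual _ norm_psi_apply_le fun φ => ?_
  refine (HL0.norm_le_norm_ofDual φ).trans
    ((HL0.ofDual φ).norm_le_of_differential (norm_nonneg _) fun x y => ?_)
  have h : φ (deriv0 x y) = φ.comp (psi X) (ptmul (deltaInf x) y) :=
    congrArg φ (psi_ptmul_deltaInf x y).symm
  rw [HL0.differential_ofDual, h]
  refine (ContinuousLinearMap.le_opNorm _ _).trans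
    (mul_le_mul_of_nonneg_left ?_ (norm_nonneg _))
  exact (norm_ptmul_le _ _).trans (mul_le_of_le_one_left (norm_nonneg _) (norm_deltaInf_le x))

/-! ### Linear functionals as test functions, and the norm of `Ψ`. -/

/-- The restriction of a functional on `X` to the ball, as a bounded holomorphic function. -/
def HInf.ofFunctional (a : StrongDual ℂ X) : HInf X :=
  HInf.ofHolo (fun x => a x) (Holo.of_differentiableAt (g := a) (fun _ => rfl) fun _ => by fun_prop)
    ‖a‖ fun x => (a.le_opNorm _).trans
      (mul_le_of_le_one_right (norm_nonneg _) (mem_ball_zero_iff.1 x.2).le)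

/-- The restriction of a functional on `X` to the ball, as an element of `HL₀(B_X)`. -/
def HL0.ofFunctional (a : StrongDual ℂ X) : HL0 X :=
  HL0.ofHolo (fun x => a x) (Holo.of_differentiableAt (g := a) (fun _ => rfl) fun _ => by fun_prop)
    ‖a‖ (fun x y => by rw [← map_sub]; exact a.le_opNorm _) (map_zero a)

theorem deriv0_apply_ofFunctional (a : StrongDual ℂ X) (x : UBall X) (y : X) :
    (deriv0 x y).toDual (HL0.ofFunctional a) = a y := by
  have h : differential (HL0.ofFunctional a).toLip.toFun x = a :=
    (differential_eq (g := a) (fun _ => rfl) x).trans a.fderiv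
  exact congrArg (fun b : StrongDual ℂ X => b y) h

/-- A functional norming `y` restricts to an element of `HL0 X` with derivative `‖y‖ ≠ 0` at the
origin in the direction `y`. -/
theorem nontrivial_G0 [Nontrivial X] : Nontrivial (G0 X) := by
  obtain ⟨y, hy⟩ := exists_ne (0 : X)
  obtain ⟨a, -, ha⟩ := exists_dual_vector ℂ y (norm_ne_zero_iff.2 hy)
  refine ⟨deriv0 (origin X) y, 0, fun h => ?_⟩
  have h1 := deriv0_apply_ofFunctional a (origin X) y
  rw [h, ha] at h1
  have h2 : (‖y‖ : ℂ) = 0 := h1.symm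
  exact hy (by simpa using h2)

/-- Every preimage of `v` has norm at least `‖v‖ / ‖T‖`, while the infimum of these norms is `‖v‖`.
-/
theorem IsQuotientOperator.one_le_norm {E F : Type*} [NormedAddCommGroup E] [NormedSpace ℂ E]
    [NormedAddCommGroup F] [NormedSpace ℂ F] [Nontrivial F] {T : E →L[ℂ] F}
    (hT : IsQuotientOperator T) : 1 ≤ ‖T‖ := by
  obtain ⟨v, hv⟩ := exists_ne (0 : F)
  have hpos : 0 < ‖T‖ := by
    rw [norm_pos_iff]
    rintro rfl
    obtain ⟨u, hu⟩ := hT.1 v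
    exact hv hu.symm
  have h1 : ‖v‖ / ‖T‖ ≤ ‖v‖ := (hT.2 v).2 <| by
    rintro _ ⟨u, rfl, rfl⟩
    rw [div_le_iff₀' hpos]
    exact T.le_opNorm u
  rw [div_le_iff₀ hpos] at h1
  exact (le_mul_iff_one_le_right (norm_pos_iff.2 hv)).1 h1

theorem norm_psi [Nontrivial X] : ‖psi X‖ = 1 := by
  have : Nontrivial (G0 X) := nontrivial_G0
  refine le_antisymm (ContinuousLinearMap.opNorm_le_bound _ zero_le_one fun u => ?_)
    isQuotientOperator_psi.one_le_norm
  rw [one_mul]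
  exact norm_psi_apply_le u

/-! ### Injectivity of `Ψ` -/

/-- If `Ψ` is injective, the functional `a ⊗ b` is represented by a function `f` with
`df(x)(y) = a(x) b(y)`, and the second derivative of `f` is symmetric. -/
theorem mul_eq_mul_of_injective_psi (hinj : Function.Injective (psi X)) (a b : StrongDual ℂ X)
    (y z : X) : a y * b z = a z * b y := by
  -- By the open mapping theorem `Ψ` is an isomorphism, so the functional `φ ⊗ y ↦ φ(a) b(y)`
  -- transports to `G0 X`, where it is represented by a function.
  let e : ProjTensor (GInf X) X ≃L[ℂ] G0 X := ContinuousLinearEquiv.ofBijective (psi X)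
    (LinearMap.ker_eq_bot.2 hinj) (LinearMap.range_eq_top.2 isQuotientOperator_psi.1)
  let ab : ProjTensor (GInf X) X →L[ℂ] ℂ := ProjTensor.lift
    (((ContinuousLinearMap.apply ℂ ℂ (HInf.ofFunctional a)).comp
      (GInf.toDualₗᵢ X).toContinuousLinearMap).smulRight b)
  let f : HL0 X := HL0.ofDual (ab.comp (e.symm : G0 X →L[ℂ] ProjTensor (GInf X) X))
  have hf : ∀ (x : UBall X) (y : X), differential f.toLip.toFun x y = a x * b y := by
    intro x y
    have h1 : e.symm (deriv0 x y) = ptmul (deltaInf x) y :=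
      e.symm_apply_eq.2 (psi_ptmul_deltaInf x y).symm
    rw [HL0.differential_ofDual]
    change ab (e.symm (deriv0 x y)) = _
    rw [h1]
    exact ProjTensor.lift_ptmul _ _ _
  have hd : ∀ᶠ x in 𝓝 (0 : X), HasFDerivAt (extend f.toLip.toFun) (a.smulRight b x) x := by
    filter_upwards [Metric.ball_mem_nhds (0 : X) one_pos] with x hx
    have h1 := (f.holo.differentiableAt ⟨x, hx⟩).hasFDerivAt
    rwa [show fderiv ℂ (extend f.toLip.toFun) x = a.smulRight b x from
      ContinuousLinearMap.ext fun y => hf ⟨x, hx⟩ y] at h1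
  -- Near the origin `df` is the linear map `x ↦ a x • b`, so the second derivative at `0` is `(y,
  -- z) ↦ a y * b z`.
  exact second_derivative_symmetric_of_eventually hd (a.smulRight b).hasFDerivAt y z

/-- With a unit vector `y` and `b y = 1`, the symmetry reads `a z = a (b z • y)` for all `a`;
functionals separate points, so every `z` is a multiple of `y`. -/
theorem nonempty_isometry_of_injective_psi [Nontrivial X] (hinj : Function.Injective (psi X)) :
    Nonempty (X ≃ₗᵢ[ℂ] ℂ) := by
  obtain ⟨w, hw⟩ := exists_ne (0 : X)
  obtain ⟨y, hy⟩ : ∃ y : X, ‖y‖ = 1 := ⟨((‖w‖⁻¹ : ℝ) : ℂ) • w, by simp [norm_smul, hw]⟩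
  obtain ⟨b, -, hb⟩ := exists_dual_vector ℂ y (by rw [hy]; exact one_ne_zero)
  have hb1 : b y = 1 := by simpa [hy] using hb
  refine ⟨(LinearIsometryEquiv.ofSurjective (LinearIsometry.toSpanSingleton ℂ X hy)
    fun z => ⟨b z, ?_⟩).symm⟩
  change b z • y = z
  refine eq_of_sub_eq_zero (SeparatingDual.eq_zero_of_forall_dual_eq_zero (R := ℂ) fun a => ?_)
  have h := mul_eq_mul_of_injective_psi hinj a b y z
  rw [hb1, mul_one] at h
  rw [map_sub, map_smul, smul_eq_mul, mul_comm, h, sub_self]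

/-! ### The one-dimensional case. -/

/-- On a one-dimensional ball every bounded holomorphic function has a primitive. -/
theorem exists_dirDeriv_eq (ι : X ≃ₗᵢ[ℂ] ℂ) (g : HInf X) :
    ∃ f : HL0 X, dirDeriv (ι.symm 1) f = g ∧ ‖f‖ ≤ ‖g‖ := by
  have hmap : ∀ z ∈ Metric.ball (0 : ℂ) 1, ι.symm z ∈ Metric.ball (0 : X) 1 := by
    intro z hz
    rwa [mem_ball_zero_iff, ι.symm.norm_map, ← mem_ball_zero_iff]
  have hG : DifferentiableOn ℂ (fun z => extend g.toBCF (ι.symm z)) (Metric.ball (0 : ℂ) 1) := by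
    intro z hz
    exact (DifferentiableAt.comp z (g.holo.differentiableAt ⟨ι.symm z, hmap z hz⟩)
      ι.symm.toContinuousLinearEquiv.differentiableAt).differentiableWithinAt
  -- The primitive exists because the domain is a disc. The value 0 at the centre places it in `HL0
  -- X`; as `ι` is isometric, the mean value inequality bounds its Lipschitz constant by `‖g‖`.
  obtain ⟨F, hF0, hF⟩ := hG.isExactOn_ball.with_val_at 0 0
  have hd : ∀ x : UBall X,
      HasFDerivAt (fun x => F (ι x)) (g.toBCF x • (ι.toContinuousLinearEquiv : X →L[ℂ] ℂ)) x := by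
    intro x
    have hx : ι x ∈ Metric.ball (0 : ℂ) 1 := by
      rw [mem_ball_zero_iff, ι.norm_map]
      exact mem_ball_zero_iff.1 x.2
    have h1 := hF (ι x) hx
    rw [ι.symm_apply_apply, extend_coe] at h1
    exact h1.comp_hasFDerivAt (x : X) ι.toContinuousLinearEquiv.hasFDerivAt
  have hbd : ∀ (x : UBall X) (y : X),
      ‖(g.toBCF x • (ι.toContinuousLinearEquiv : X →L[ℂ] ℂ)) y‖ ≤ ‖g‖ * ‖y‖ := by
    intro x y
    change ‖g.toBCF x * ι y‖ ≤ _
    rw [norm_mul, ι.norm_map]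
    exact mul_le_mul_of_nonneg_right (g.norm_apply_le x) (norm_nonneg _)
  let f : HL0 X := HL0.ofHolo (fun x => F (ι x))
    (Holo.of_differentiableAt (g := fun x => F (ι x)) (fun _ => rfl)
      fun x => (hd x).differentiableAt) ‖g‖
    (fun x y => (convex_ball (0 : X) 1).norm_image_sub_le_of_norm_hasFDerivWithin_le (𝕜 := ℂ)
      (f' := fun x => extend g.toBCF x • (ι.toContinuousLinearEquiv : X →L[ℂ] ℂ))
      (fun z hz => by
        have h1 := hd ⟨z, hz⟩
        rw [← extend_coe g.toBCF ⟨z, hz⟩] at h1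
        exact h1.hasFDerivWithinAt)
      (fun z hz => ContinuousLinearMap.opNorm_le_bound _ (norm_nonneg _) fun y => by
        have h1 := hbd ⟨z, hz⟩ y
        rwa [← extend_coe g.toBCF ⟨z, hz⟩] at h1) y.2 x.2)
    (by rw [show ((origin X : UBall X) : X) = 0 from rfl, map_zero, hF0])
  have hf : ∀ x : UBall X, differential f.toLip.toFun x =
      g.toBCF x • (ι.toContinuousLinearEquiv : X →L[ℂ] ℂ) := fun x =>
    (differential_eq (g := fun x => F (ι x)) (fun _ => rfl) x).trans (hd x).fderiv
  refine ⟨f, HInf.ext fun x => ?_, f.norm_le_of_differential (norm_nonneg _) fun x y => ?_⟩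
  · rw [dirDeriv_apply, hf]
    change g.toBCF x * ι (ι.symm 1) = _
    rw [ι.apply_symm_apply, mul_one]
  · rw [hf]
    exact hbd x y

/-- Every `g` is a derivative of some `f` with `‖f‖ ≤ ‖g‖`, so testing on such `f` loses nothing of
`‖φ‖`. -/
theorem norm_psiBilin_of_isometry (ι : X ≃ₗᵢ[ℂ] ℂ) (φ : GInf X) :
    ‖psiBilin X φ (ι.symm 1)‖ = ‖φ‖ := by
  refine le_antisymm ?_ ?_
  · rw [← psi_ptmul]
    refine (norm_psi_apply_le _).trans ((norm_ptmul_le _ _).trans_eq ?_)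
    rw [ι.symm.norm_map, norm_one, mul_one]
  · refine ContinuousLinearMap.opNorm_le_bound φ.toDual (norm_nonneg _) fun g => ?_
    obtain ⟨f, rfl, hle⟩ := exists_dirDeriv_eq ι g
    rw [← psiBilin_apply]
    exact ((psiBilin X φ (ι.symm 1)).toDual.le_opNorm f).trans
      (mul_le_mul_of_nonneg_left hle (norm_nonneg _))

/-- The lower bound comes from `Ψ`: it is short, and its value on this tensor already has norm
`‖φ‖`. -/
theorem norm_ptmul_of_isometry (ι : X ≃ₗᵢ[ℂ] ℂ) (φ : GInf X) :
    ‖ptmul φ (ι.symm 1)‖ = ‖φ‖ := by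
  refine le_antisymm ?_ ?_
  · refine (norm_ptmul_le _ _).trans_eq ?_
    rw [ι.symm.norm_map, norm_one, mul_one]
  · rw [← norm_psiBilin_of_isometry ι φ, ← psi_ptmul]
    exact norm_psi_apply_le _

/-- Tensoring with a unit vector is isometric on the complete space `GInf X`, so its range is
closed. The range contains all elementary tensors, since scalars move to the first factor. -/
theorem exists_eq_ptmul_of_isometry (ι : X ≃ₗᵢ[ℂ] ℂ) (u : ProjTensor (GInf X) X) :
    ∃ φ, ptmul φ (ι.symm 1) = u := by
  let J : GInf X →ₗᵢ[ℂ] ProjTensor (GInf X) X :=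
    ⟨((ptmulL (GInf X) X).flip (ι.symm 1) : GInf X →ₗ[ℂ] _), norm_ptmul_of_isometry ι⟩
  have hclosed : IsClosed (LinearMap.range J.toLinearMap : Set (ProjTensor (GInf X) X)) :=
    J.isometry.isClosedEmbedding.isClosed_range
  refine PreProj.denseRange_toProj.induction_on
    (p := fun u => u ∈ LinearMap.range J.toLinearMap) u hclosed fun w => ?_
  refine PreProj.induction
    (p := fun w => PreProj.toProj (GInf X) X w ∈ LinearMap.range J.toLinearMap) w ?_ ?_ ?_
  · rw [map_zero]
    exact Submodule.zero_mem _
  · intro φ y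
    refine ⟨ι y • φ, ?_⟩
    have h1 : y = ι y • ι.symm 1 := by
      rw [← map_smul, smul_eq_mul, mul_one, ι.symm_apply_apply]
    calc ptmulL (GInf X) X (ι y • φ) (ι.symm 1) = ptmulL (GInf X) X φ (ι y • ι.symm 1) := by
          rw [map_smul, map_smul]; rfl
      _ = ptmulL (GInf X) X φ y := by rw [← h1]
  · intro v w hv hw
    rw [map_add]
    exact Submodule.add_mem _ hv hw

theorem injective_psi_of_isometry (ι : X ≃ₗᵢ[ℂ] ℂ) : Function.Injective (psi X) := by
  refine (injective_iff_map_eq_zero _).2 fun u hu => ?_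
  obtain ⟨φ, rfl⟩ := exists_eq_ptmul_of_isometry ι u
  rw [psi_ptmul, ← norm_eq_zero, norm_psiBilin_of_isometry, ← norm_ptmul_of_isometry ι,
    norm_eq_zero] at hu
  exact hu

/-- On a one-dimensional ball `φ ↦ Ψ(φ ⊗ y)`, for a unit vector `y`, is an isometric
isomorphism. -/
def isometryOfOneDim (ι : X ≃ₗᵢ[ℂ] ℂ) : GInf X ≃ₗᵢ[ℂ] G0 X :=
  LinearIsometryEquiv.ofSurjective
    ⟨((psiBilin X).flip (ι.symm 1) : GInf X →ₗ[ℂ] G0 X), norm_psiBilin_of_isometry ι⟩ fun v => by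
      obtain ⟨u, rfl⟩ := isQuotientOperator_psi.1 v
      obtain ⟨φ, rfl⟩ := exists_eq_ptmul_of_isometry ι u
      exact ⟨φ, (psi_ptmul _ _).symm⟩

theorem isometryOfOneDim_deltaInf (ι : X ≃ₗᵢ[ℂ] ℂ) (x : UBall X) :
    (isometryOfOneDim ι (deltaInf x)).toDual = evalDeriv x (ι.symm 1) := rfl

end Psi

end HolLip

end

theorem mainTheorem8 (X : Type*) [NormedAddCommGroup X] [NormedSpace ℂ X] [CompleteSpace X] :
    (∃ π : HolLip.LipFree X →L[ℂ] HolLip.G0 X,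
      (∀ x : HolLip.UBall X, π (HolLip.deltaF x) = HolLip.delta0 x) ∧
      (∀ π' : HolLip.LipFree X →L[ℂ] HolLip.G0 X,
        (∀ x : HolLip.UBall X, π' (HolLip.deltaF x) = HolLip.delta0 x) → π' = π) ∧
      HolLip.IsQuotientOperator π ∧
      LinearMap.ker (π : HolLip.LipFree X →ₗ[ℂ] HolLip.G0 X) = HolLip.HL0perp X ∧
      ∃ e : (HolLip.LipFree X ⧸ HolLip.HL0perp X) ≃ₗᵢ[ℂ] HolLip.G0 X,
        ∀ μ : HolLip.LipFree X, e (Submodule.Quotient.mk μ) = π μ) ∧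
    (∃ Ψ : HolLip.ProjTensor (HolLip.GInf X) X →L[ℂ] HolLip.G0 X,
      (∀ (x : HolLip.UBall X) (y : X),
        (Ψ (HolLip.ptmul (HolLip.deltaInf x) y)).toDual
          = HolLip.evalDeriv x y) ∧
      (∀ Ψ' : HolLip.ProjTensor (HolLip.GInf X) X →L[ℂ] HolLip.G0 X,
        (∀ (x : HolLip.UBall X) (y : X),
          (Ψ' (HolLip.ptmul (HolLip.deltaInf x) y)).toDual
            = HolLip.evalDeriv x y) → Ψ' = Ψ) ∧
      HolLip.IsQuotientOperator Ψ ∧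
      (Nontrivial X →
        ‖Ψ‖ = 1 ∧ (Function.Injective Ψ ↔ Nonempty (X ≃ₗᵢ[ℂ] ℂ)))) ∧
    (∃ e : HolLip.GInf ℂ ≃ₗᵢ[ℂ] HolLip.G0 ℂ,
      ∀ x : HolLip.UBall ℂ,
        (e (HolLip.deltaInf x)).toDual = HolLip.evalDeriv x 1) := by
  refine ⟨⟨HolLip.restrictFree X, HolLip.restrictFree_deltaF, fun π' h => ?_,
      HolLip.isQuotientOperator_restrictFree, HolLip.ker_restrictFree,
      HolLip.isQuotientOperator_restrictFree.exists_quotient_equiv HolLip.ker_restrictFree⟩,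
    ⟨HolLip.psi X, fun x y => ?_, fun Ψ' h => ?_, HolLip.isQuotientOperator_psi, fun _ =>
      ⟨HolLip.norm_psi, HolLip.nonempty_isometry_of_injective_psi,
        fun ⟨ι⟩ => HolLip.injective_psi_of_isometry ι⟩⟩,
    ⟨HolLip.isometryOfOneDim (LinearIsometryEquiv.refl ℂ ℂ),
      HolLip.isometryOfOneDim_deltaInf (LinearIsometryEquiv.refl ℂ ℂ)⟩⟩
  · exact HolLip.LipFree.hom_ext h
  · rw [HolLip.psi_ptmul_deltaInf]
    rfl
  · refine HolLip.projTensor_hom_ext fun x y => ?_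
    rw [HolLip.psi_ptmul_deltaInf]
    exact Subtype.ext (h x y)
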